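/- Identify $\mathbb{R}^{2\times2}$ with the matrices carrying the Frobenius inner product, write $x_{ij}$ for the coefficient of $e_i\otimes e_j$, let $B_1\subset\mathbb{R}^2$ be the open unit disc with outer normal $\nu_x=x$, and for $f:\mathbb{R}^{2\times 2}\to\mathbb{R}$ let $f^\infty(\xi)=\lim_{t\to\infty}f(t\xi)/t$. **Theorem.** There is an even, positively $1$-homogeneous norm $f:\mathbb{R}^{2\times2}\to\mathbb{R}$, of class $C^\infty$ on $\mathbb{R}^{2\times 2}\setminus\{0\}$, with the following properties. 1. *(Structural assumptions.)* $f$ is convex; there is $C_1>0$ with $\frac1{C_1}|\xi|-C_1\le f(\xi)\le C_1(|\xi|+1)$ for all $\xi$; there is $R>0$ with $f\in C^2(\mathbb{R}^{2\times2}\setminus B_R(0))\cap C^1(\mathbb{R}^{2\times2}\setminus\{0\})$; as $a\to+\infty$, $$\sup_{|\xi|\ge a}|\xi|\int_{|\xi|}^\infty \Big\langle \mathrm{D}^2f\big(s\tfrac{\xi}{|\xi|}\big)\tfrac{\xi}{|\xi|},\tfrac{\xi}{|\xi|}\Big\rangle\,\mathrm{d}s\to0;$$ $f^\infty\in C^2(\mathbb{R}^{2\times2}\setminus\{0\})$;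 there is $C_2>0$ with $\mathrm{D}^2((f^\infty)^2)(\xi)\ge C_2\,\mathrm{Id}$ for all $\xi\ne0$; and whenever $\xi,\xi'\neq0$ satisfy $\mathrm{D}f^\infty(\xi')=\mathrm{D}f(\xi)$, then $\mathrm{D}f^\infty(\xi')=\mathrm{D}f^\infty(\xi)$. 2. *(Failure of quasi-isotropy.)* There are no positively $0$-homogeneous and odd maps $\mu_1,\mu_2:\mathbb{R}^2\to\mathbb{R}^2$ with $\mathrm{D}f^\infty(v_1\otimes v_2)=\mu_1(v_1)\otimes\mu_2(v_2)$ for all $v_1,v_2\ne0$. 3. *(Form of $f$ and its gradient.)* There is $\varepsilon>0$ such that: - there is an even function $\eta\in C^\infty(\mathbb{R}^{2\times2};[0,1])$, equal to $1$ at distance at most $10\varepsilon$ from $\{\pm e_1\otimes e_1\}$ and equal to $0$ at distance at least $20\varepsilon$ from this set, such that, with $\mathfrak q$ the $2$-homogeneous extension of the restriction of $y\mapsto 2\eta(y)\,y_{21}^2y_{22}/y_{11}$ to the unit sphere and $Ax=x+x_{21}\,e_1\otimes e_2+x_{12}\,e_2\otimes e_1+x_{12}\,e_1\otimes e_2$,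 the function $f_{*}(x)=\sqrt{\langle Ax,x\rangle+\mathfrak q(x)}$ is a norm and $f(x)=\sup\{\langle x,y\rangle: f_{*}(y)\le1\}$; - for all $a,b\in\mathbb{R}$ with $|b|<\varepsilon|a|$ and $v=ae_1+be_2$, $f$ is differentiable at $v\otimes v$ with $$\mathrm{D}f(v\otimes v)=a\,\frac{v\otimes e_1}{f(v\otimes v)}.$$ 4. *(Non-attainment.)* There is $u_0\in C^\infty(\partial B_1;\mathbb{R}^2)$, not identically $0$, such that $u=0$ minimizes $$\int_{B_1} f(\mathrm{D}^aw)\,\mathrm{d}x+\int_{B_1} f^\infty\Big(\frac{\mathrm{d}\mathrm{D}^sw}{\mathrm{d}|\mathrm{D}^sw|}\Big)\,\mathrm{d}|\mathrm{D}^sw|+\int_{\partial B_1}f^\infty\big((u_0-w)\otimes\nu_x\big)\,\mathrm{d}\mathcal{H}^1$$ among all $w\in BV(B_1,\mathbb{R}^2)$, where $\mathrm{D}^aw$ and $\mathrm{D}^sw$ are the absolutely continuous and singular parts of the measure $\mathrm{D}w$ and $w$ on $\partial B_1$ denotes the trace. In particular, the trace of $u=0$ differs from $u_0$ on a subset of $\partial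 B_1$ of positive $\mathcal{H}^1$-measure. -/

import Mathlib

open MeasureTheory Set Filter Topology
open scoped ContDiff RealInnerProductSpace

noncomputable section

namespace BoundaryExample

/-- The Euclidean plane `ℝ²`. -/
abbrev Plane : Type := EuclideanSpace ℝ (Fin 2)

/-- The real `2 × 2` matrices with the Frobenius inner product; `ξ (i, j)` is the coefficient of
`e_i ⊗ e_j`. -/
abbrev Mat : Type := EuclideanSpace ℝ (Fin 2 × Fin 2)

/-- The tensor product `v ⊗ w`, with entries `v_i w_j`. -/
def tensor (v w : Plane) : Mat := WithLp.toLp 2 fun p => v p.1 * w p.2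

/-- The standard basis vectors of the plane, indexed by `0` and `1`. -/
def basisVec (j : Fin 2) : Plane := EuclideanSpace.single j 1

/-! ### Integrands -/

/-- The recession function `ξ ↦ lim_{t → ∞} f(t ξ) / t`. -/
def recession (f : Mat → ℝ) (ξ : Mat) : ℝ :=
  limUnder atTop fun t : ℝ => f (t • ξ) / t

/-- The second derivative of `f` at `ξ` as a bilinear form, evaluated at `(η, η)`. -/
def secondDeriv (f : Mat → ℝ) (ξ η : Mat) : ℝ :=
  fderiv ℝ (fderiv ℝ f) ξ η η

/-- The standing structural assumptions on a convex integrand of linear growth, without the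
quasi-isotropy condition. -/
structure AdmissibleIntegrand (f : Mat → ℝ) : Prop where
  convex : ConvexOn ℝ univ f
  growth : ∃ C : ℝ, 0 < C ∧ ∀ ξ, C⁻¹ * ‖ξ‖ - C ≤ f ξ ∧ f ξ ≤ C * (‖ξ‖ + 1)
  regular : (∃ R : ℝ, 0 < R ∧ ContDiffOn ℝ 2 f (Metric.ball 0 R)ᶜ) ∧ ContDiffOn ℝ 1 f {0}ᶜ
  /-- The integrand of the inner integral is nonnegative for large arguments by convexity, so the
  integral is taken with values in `[0, ∞]`. -/
  almost_homogeneous :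
    Tendsto (fun a : ℝ => ⨆ (ξ : Mat) (_ : a ≤ ‖ξ‖), ENNReal.ofReal ‖ξ‖ *
      ∫⁻ s in Ioi ‖ξ‖, ENNReal.ofReal (secondDeriv f (s • ‖ξ‖⁻¹ • ξ) (‖ξ‖⁻¹ • ξ)))
      atTop (𝓝 0)
  recession_regular : ContDiffOn ℝ 2 (recession f) {0}ᶜ
  uniformly_convex : ∃ C : ℝ, 0 < C ∧ ∀ ξ : Mat, ξ ≠ 0 → ∀ η : Mat,
    C * ‖η‖ ^ 2 ≤ secondDeriv (fun x => recession f x ^ 2) ξ η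
  gradient_compat : ∀ ξ ξ' : Mat, ξ ≠ 0 → ξ' ≠ 0 →
    gradient (recession f) ξ' = gradient f ξ →
    gradient (recession f) ξ' = gradient (recession f) ξ

/-- Quasi-isotropy: on rank-one matrices the gradient of the recession function splits as
`D f^∞(v₁ ⊗ v₂) = μ₁(v₁) ⊗ μ₂(v₂)` with positively `0`-homogeneous and odd `μ₁`, `μ₂`. -/
def QuasiIsotropic (f : Mat → ℝ) : Prop :=
  ∃ μ₁ μ₂ : Plane → Plane,
    (∀ t : ℝ, 0 < t → ∀ v, μ₁ (t • v) = μ₁ v ∧ μ₂ (t • v) = μ₂ v) ∧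
    (∀ v, μ₁ (-v) = -μ₁ v ∧ μ₂ (-v) = -μ₂ v) ∧
    ∀ v₁ v₂ : Plane, v₁ ≠ 0 → v₂ ≠ 0 →
      HasGradientAt (recession f) (tensor (μ₁ v₁) (μ₂ v₂)) (tensor v₁ v₂)

/-- `g` is a norm on the space of matrices. -/
structure IsNorm (g : Mat → ℝ) : Prop where
  smul : ∀ (c : ℝ) (x : Mat), g (c • x) = |c| * g x
  add_le : ∀ x y : Mat, g (x + y) ≤ g x + g y
  eq_zero : ∀ x : Mat, g x = 0 → x = 0

/-- The dual norm `x ↦ sup {⟨x, y⟩ : g(y) ≤ 1}`. -/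
def dualNorm (g : Mat → ℝ) (x : Mat) : ℝ :=
  sSup ((fun y : Mat => ⟪x, y⟫) '' {y | g y ≤ 1})

/-- The linear map `A x = x + x₂₁ e₁⊗e₂ + x₁₂ e₂⊗e₁ + x₁₂ e₁⊗e₂`
(indices are shifted by one in the code). -/
def quadMap (x : Mat) : Mat :=
  x + x (1, 0) • tensor (basisVec 0) (basisVec 1)
    + x (0, 1) • tensor (basisVec 1) (basisVec 0)
    + x (0, 1) • tensor (basisVec 0) (basisVec 1)

/-- `η` is a smooth even cutoff function with values in `[0, 1]`, equal to `1` at distance at most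
`10 ε` from `{e₁⊗e₁, -e₁⊗e₁}` and supported at distance at most `20 ε` from that set. -/
structure IsCutoff (ε : ℝ) (η : Mat → ℝ) : Prop where
  smooth : ContDiff ℝ ∞ η
  even : ∀ x, η (-x) = η x
  mem_Icc : ∀ x, η x ∈ Icc (0 : ℝ) 1
  eq_one : ∀ x, ‖x - tensor (basisVec 0) (basisVec 0)‖ ≤ 10 * ε → η x = 1
  eq_zero : ∀ x, 20 * ε ≤ ‖x - tensor (basisVec 0) (basisVec 0)‖ →
    20 * ε ≤ ‖x + tensor (basisVec 0) (basisVec 0)‖ → η x = 0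

/-- The perturbation `q`: the `2`-homogeneous extension of the restriction of
`y ↦ η(y) · 2 y₂₁² y₂₂ / y₁₁` to the unit sphere. -/
def perturbation (η : Mat → ℝ) (x : Mat) : ℝ :=
  ‖x‖ ^ 2 * (η (‖x‖⁻¹ • x) *
    (2 * (‖x‖⁻¹ • x) (1, 0) ^ 2 * (‖x‖⁻¹ • x) (1, 1) / (‖x‖⁻¹ • x) (0, 0)))

/-- The perturbed quadratic norm `x ↦ √(A x · x + q(x))`. -/
def perturbedQuadratic (η : Mat → ℝ) (x : Mat) : ℝ :=
  Real.sqrt (⟪quadMap x, x⟫ + perturbation η x)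

/-! ### Functions of bounded variation on the unit disc -/

/-- The open unit disc. -/
def disc : Set Plane := Metric.ball 0 1

/-- The unit circle, the boundary of the disc; its outer unit normal at `x` is `x`. -/
def circle : Set Plane := Metric.sphere 0 1

/-- The length measure `H¹` on the unit circle. -/
def circleMeasure : Measure Plane := (Measure.hausdorffMeasure 1).restrict circle

/-- The partial derivative `∂_j φ`. -/
def partialDeriv (j : Fin 2) (φ : Plane → ℝ) (x : Plane) : ℝ := fderiv ℝ φ x (basisVec j)

/-- A function `w ∈ BV(B₁, ℝ²)`: an integrable function on the disc whose distributional derivative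
is a finite matrix-valued Radon measure `Dw`. The measure is recorded by its polar decomposition
`Dw = polar · variation`, where `variation = |Dw|` is the total variation measure and
`polar = dDw/d|Dw|` has norm one almost everywhere; both are determined by `w`. -/
structure BVFunction where
  toFun : Plane → Plane
  variation : Measure Plane
  polar : Plane → Mat
  integrable : IntegrableOn toFun disc
  finite : IsFiniteMeasure variation
  concentrated : variation discᶜ = 0
  polar_measurable : Measurable polar
  polar_norm : ∀ᵐ x ∂variation, ‖polar x‖ = 1
  derivative : ∀ φ : Plane → ℝ, ContDiff ℝ ∞ φ → HasCompactSupport φ → tsupport φ ⊆ disc →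
    ∀ i j : Fin 2,
      -∫ x in disc, toFun x i * partialDeriv j φ x = ∫ x, φ x * polar x (i, j) ∂variation

/-- The zero function as a function of bounded variation. -/
instance : Zero BVFunction where
  zero :=
    { toFun := 0
      variation := 0
      polar := 0
      integrable := integrableOn_zero
      finite := inferInstance
      concentrated := by simp
      polar_measurable := measurable_const
      polar_norm := by simp
      derivative := by intros; simp }

namespace BVFunction

/-- The density `D^a w` of the absolutely continuous part of `Dw`. -/
def acDensity (w : BVFunction) (x : Plane) : Mat :=
  (w.variation.rnDeriv volume x).toReal • w.polar x

/-- The total variation `|D^s w|` of the singular part of `Dw`. The density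
`dD^s w / d|D^s w|` is `polar`. -/
def singularVariation (w : BVFunction) : Measure Plane := w.variation.singularPart volume

/-- `T` is the boundary trace of `w`, characterised by the Gauss-Green formula. Every function of
bounded variation on the disc has exactly one trace, up to null sets of the circle. -/
structure IsTrace (w : BVFunction) (T : Plane → Plane) : Prop where
  integrable : Integrable T circleMeasure
  gauss_green : ∀ φ : Plane → ℝ, ContDiff ℝ ∞ φ → ∀ i j : Fin 2,
    ∫ x in disc, w.toFun x i * partialDeriv j φ x =
      -∫ x, φ x * w.polar x (i, j) ∂w.variation + ∫ x, T x i * φ x * x j ∂circleMeasure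

end BVFunction

/-- The relaxed functional on the unit disc for the integrand `f` and the boundary datum `u₀`,
evaluated at a function `w` of bounded variation with trace `T`:
`∫ f(D^a w) dx + ∫ f^∞(dD^s w / d|D^s w|) d|D^s w| + ∫_{∂B₁} f^∞((u₀ - w) ⊗ ν) dH¹`. -/
def relaxedFunctional (f : Mat → ℝ) (u₀ : Plane → Plane) (w : BVFunction) (T : Plane → Plane) :
    ℝ :=
  (∫ x in disc, f (w.acDensity x)) + (∫ x, recession f (w.polar x) ∂w.singularVariation)
    + ∫ x, recession f (tensor (u₀ x - T x) x) ∂circleMeasure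

/-- `u` minimises the relaxed functional among all functions of bounded variation. -/
def IsRelaxedMinimizer (f : Mat → ℝ) (u₀ : Plane → Plane) (u : BVFunction) : Prop :=
  ∃ Tu, u.IsTrace Tu ∧ ∀ (w : BVFunction) (Tw : Plane → Plane), w.IsTrace Tw →
    relaxedFunctional f u₀ u Tu ≤ relaxedFunctional f u₀ w Tw

end BoundaryExample

end

/-!
The integrand is the dual norm `f` of `f_* = √(⟨A y, y⟩ + q y)`, where `q` is the perturbation for
a smooth even cutoff of width `ε`.

*Regularity of `f`.* The perturbation vanishes to third order at `±e₁ ⊗ e₁`. After blowing up the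
entries other than the first one by `ε⁻¹` it becomes `ε³` times a function that stays smooth up to
`ε = 0`, so its second derivative is `O(ε)` (`exists_norm_fderiv_fderiv_perturbation_le`). For
small `ε` it is thus dominated by the coercivity of `A` (`IsSmallPerturbation`), so half of the
gradient of `f_*²` is Lipschitz, strongly monotone and bijective, and it is a diffeomorphism away
from the origin. This makes `f_*` a norm (`IsSmallPerturbation.sqrt_perturbedForm_add_le`). By
convex duality `½ f²` is the conjugate of `½ f_*²` and its gradient is the inverse map
(`IsSmallPerturbation.hasFDerivAt_dualNorm_sq`), which gives the smoothness of `f` and the uniform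
convexity of `f²`.

*Gradient at `v ⊗ v`.* For `v = a e₁ + b e₂` close to the first axis, half of the gradient of `f_*²`
at `a v ⊗ e₁` is `v ⊗ v` (`halfGradient_smul_tensor`), hence `D f (v ⊗ v) = a v ⊗ e₁ / f (v ⊗ v)`
and `f (v ⊗ v) = |a| |v|`. If the gradient of `f` split on rank-one matrices, this formula and
Euler's relation would determine the product of `f (v ⊗ e₁)` and `f (e₁ ⊗ v)`. The product is
larger, since `y = v ⊗ e₁ - (b / 2) e₁ ⊗ e₂` is a better competitor for `f (v ⊗ e₁)` than `v ⊗ e₁`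
(`not_quasiIsotropic`).

*Non-attainment.* The field `(√(1 - x₂²) e₁ + x₂ e₂) ⊗ e₁` does not depend on `x₁`, so it is
divergence free, and its `f_*` norm is one. On the right half of the circle it equals `x ⊗ e₁`,
which is the gradient of `f` at `x ⊗ x` near `e₁`. It therefore calibrates the zero function for a
datum `u₀ x = c x`, where `c ≥ 0` is supported in a small arc around `e₁`: the relaxed functional of
any competitor is at least the flux of the field against `u₀` (`calibration_le`), and this flux is
the value at zero (`dualNorm_boundaryDatum`).
-/

namespace BoundaryExample

/-! ### Small homogeneous perturbations of quadratic forms -/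

section SmallPerturbation

variable {E F : Type*} [NormedAddCommGroup E] [NormedAddCommGroup F] [NormedSpace ℝ F]

/-- Euler's relation for a map that is positively homogeneous along the ray through `x`. -/
theorem fderiv_apply_self_of_homogeneous [NormedSpace ℝ E] {u : E → F} {u' : E →L[ℝ] F} {x : E}
    {k : ℕ} (hu : HasFDerivAt u u' x) (h : ∀ t : ℝ, 0 < t → u (t • x) = t ^ k • u x) :
    u' x = (k : ℝ) • u x := by
  have h1 : HasDerivAt (fun t : ℝ => u (t • x)) (u' x) 1 := by
    have h2 : HasDerivAt (fun t : ℝ => t • x) ((1 : ℝ) • x) 1 := (hasDerivAt_id 1).smul_const x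
    rw [one_smul] at h2
    have hu1 : HasFDerivAt u u' ((1 : ℝ) • x) := by rwa [one_smul]
    exact hu1.comp_hasDerivAt (1 : ℝ) h2
  have h3 : HasDerivAt (fun t : ℝ => t ^ k • u x) ((k * (1 : ℝ) ^ (k - 1)) • u x) 1 :=
    (hasDerivAt_pow k 1).smul_const (u x)
  have h4 : (fun t : ℝ => u (t • x)) =ᶠ[𝓝 1] fun t : ℝ => t ^ k • u x := by
    filter_upwards [lt_mem_nhds one_pos] with t ht using h t ht
  simpa using h1.unique (h3.congr_of_eventuallyEq h4)

variable [InnerProductSpace ℝ E]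

/-- A symmetric coercive operator `A` together with a `2`-homogeneous function `q`, smooth away from
the origin, whose second derivative does not exceed the coercivity constant of `A`. Since only half
of `q` enters the gradient of `½ (⟨A x, x⟩ + q x)`, this gradient is then strongly monotone. -/
structure IsSmallPerturbation (A : E →L[ℝ] E) (q : E → ℝ) (c : ℝ) : Prop where
  pos : 0 < c
  symm : ∀ x y, ⟪A x, y⟫ = ⟪x, A y⟫
  coercive : ∀ x, c * ‖x‖ ^ 2 ≤ ⟪A x, x⟫
  homogeneous : ∀ (t : ℝ) (x : E), q (t • x) = t ^ 2 * q x
  smooth : ContDiffOn ℝ ∞ q {0}ᶜ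
  hessian_le : ∀ x, x ≠ 0 → ‖fderiv ℝ (fderiv ℝ q) x‖ ≤ c

/-- The perturbed quadratic form `⟨A x, x⟩ + q x`. -/
noncomputable def perturbedForm (A : E →L[ℝ] E) (q : E → ℝ) (x : E) : ℝ := ⟪A x, x⟫ + q x

/-- Half of the gradient of the perturbed quadratic form. -/
noncomputable def halfGradient [CompleteSpace E] (A : E →L[ℝ] E) (q : E → ℝ) (x : E) : E :=
  A x + (1 / 2 : ℝ) • gradient q x

namespace IsSmallPerturbation

variable {A : E →L[ℝ] E} {q : E → ℝ} {c : ℝ}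

theorem contDiffAt (h : IsSmallPerturbation A q c) {x : E} (hx : x ≠ 0) : ContDiffAt ℝ ∞ q x :=
  h.smooth.contDiffAt (isOpen_compl_singleton.mem_nhds hx)

theorem contDiffAt_fderiv (h : IsSmallPerturbation A q c) {x : E} (hx : x ≠ 0) :
    ContDiffAt ℝ ∞ (fderiv ℝ q) x :=
  (h.contDiffAt hx).fderiv_right (by simp)

theorem hasFDerivAt_fderiv (h : IsSmallPerturbation A q c) {x : E} (hx : x ≠ 0) :
    HasFDerivAt (fderiv ℝ q) (fderiv ℝ (fderiv ℝ q) x) x :=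
  ((h.contDiffAt_fderiv hx).differentiableAt (by simp)).hasFDerivAt

theorem fderiv_smul_of_ne_zero (h : IsSmallPerturbation A q c) {t : ℝ} (ht : t ≠ 0) (x : E) :
    fderiv ℝ q (t • x) = t • fderiv ℝ q x := by
  have h1 : fderiv ℝ (fun x => q (t • x)) x = t • fderiv ℝ q (t • x) := fderiv_comp_smul t
  have h2 : (fun x => q (t • x)) = fun x => t ^ 2 • q x := by
    ext y; simp [h.homogeneous]
  have h3 : fderiv ℝ (fun x => t ^ 2 • q x) x = t ^ 2 • fderiv ℝ q x :=
    congrFun (fderiv_const_smul_field (f := q) (t ^ 2)) x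
  rw [h2, h3, pow_two, mul_smul] at h1
  exact (smul_right_injective _ ht h1).symm

/-- By Euler's relation `D q (x) = D² q (x) x`. -/
theorem norm_fderiv_le_of_ne_zero (h : IsSmallPerturbation A q c) {x : E} (hx : x ≠ 0) :
    ‖fderiv ℝ q x‖ ≤ c * ‖x‖ := by
  have h1 := fderiv_apply_self_of_homogeneous (k := 1) (h.hasFDerivAt_fderiv hx)
    (fun t ht => by rw [h.fderiv_smul_of_ne_zero ht.ne', pow_one])
  rw [Nat.cast_one, one_smul] at h1
  rw [← h1]
  exact ContinuousLinearMap.le_of_opNorm_le _ (h.hessian_le x hx) x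

theorem map_zero (h : IsSmallPerturbation A q c) : q 0 = 0 := by
  have := h.homogeneous 0 0
  simpa using this

theorem abs_le (h : IsSmallPerturbation A q c) (x : E) : |q x| ≤ c / 2 * ‖x‖ ^ 2 := by
  rcases eq_or_ne x 0 with rfl | hx
  · simp [h.map_zero]
  have h1 := fderiv_apply_self_of_homogeneous (k := 2)
    ((h.contDiffAt hx).differentiableAt (by simp)).hasFDerivAt
    (fun t _ => by rw [h.homogeneous, smul_eq_mul])
  have h2 := ContinuousLinearMap.le_of_opNorm_le _ (h.norm_fderiv_le_of_ne_zero hx) x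
  rw [h1, smul_eq_mul, Real.norm_eq_abs, abs_mul] at h2
  simp only [Nat.cast_ofNat, Nat.abs_ofNat] at h2
  nlinarith

theorem hasFDerivAt_zero (h : IsSmallPerturbation A q c) :
    HasFDerivAt q (0 : E →L[ℝ] ℝ) 0 := by
  rw [hasFDerivAt_iff_isLittleO_nhds_zero]
  have h1 : (fun x : E => q (0 + x) - q 0 - (0 : E →L[ℝ] ℝ) x) = q := by
    ext x; simp [h.map_zero]
  rw [h1]
  have h2 : q =O[𝓝 0] fun x : E => ‖x‖ ^ 2 := by
    refine Asymptotics.IsBigO.of_bound (c / 2) (Eventually.of_forall fun x => ?_)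
    simpa using h.abs_le x
  exact h2.trans_isLittleO (Asymptotics.isLittleO_norm_pow_id one_lt_two)

theorem differentiable (h : IsSmallPerturbation A q c) : Differentiable ℝ q := fun x => by
  rcases eq_or_ne x 0 with rfl | hx
  · exact h.hasFDerivAt_zero.differentiableAt
  · exact (h.contDiffAt hx).differentiableAt (by simp)

theorem fderiv_zero (h : IsSmallPerturbation A q c) : fderiv ℝ q 0 = 0 := h.hasFDerivAt_zero.fderiv

theorem norm_fderiv_le (h : IsSmallPerturbation A q c) (x : E) : ‖fderiv ℝ q x‖ ≤ c * ‖x‖ := by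
  rcases eq_or_ne x 0 with rfl | hx
  · simp [h.fderiv_zero]
  · exact h.norm_fderiv_le_of_ne_zero hx

theorem norm_fderiv_sub_le (h : IsSmallPerturbation A q c) (x y : E) :
    ‖fderiv ℝ q x - fderiv ℝ q y‖ ≤ c * ‖x - y‖ := by
  by_cases h0 : (0 : E) ∈ segment ℝ y x
  · -- the segment passes through the origin, where `q` need not be twice differentiable
    have h1 : ‖x - y‖ = ‖y‖ + ‖x‖ := by
      have := (mem_segment_iff_sameRay.1 h0).norm_add
      simpa [sub_eq_add_neg, add_comm] using this
    calc ‖fderiv ℝ q x - fderiv ℝ q y‖ ≤ ‖fderiv ℝ q x‖ + ‖fderiv ℝ q y‖ := norm_sub_le _ _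
      _ ≤ c * ‖x‖ + c * ‖y‖ := add_le_add (h.norm_fderiv_le x) (h.norm_fderiv_le y)
      _ = c * ‖x - y‖ := by rw [h1]; ring
  · have hne : ∀ z ∈ segment ℝ y x, z ≠ 0 := fun z hz hz0 => h0 (hz0 ▸ hz)
    exact (convex_segment y x).norm_image_sub_le_of_norm_hasFDerivWithin_le
      (fun z hz => (h.hasFDerivAt_fderiv (hne z hz)).hasFDerivWithinAt)
      (fun z hz => h.hessian_le z (hne z hz)) (left_mem_segment ℝ y x) (right_mem_segment ℝ y x)

theorem abs_sub_sub_fderiv_le (h : IsSmallPerturbation A q c) (x y : E) :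
    |q y - q x - fderiv ℝ q x (y - x)| ≤ c * ‖y - x‖ ^ 2 := by
  have h1 := (convex_segment x y).norm_image_sub_le_of_norm_hasFDerivWithin_le'
      (f := q) (φ := fderiv ℝ q x) (C := c * ‖y - x‖)
      (fun z _ => (h.differentiable z).hasFDerivAt.hasFDerivWithinAt)
      (fun z hz => (h.norm_fderiv_sub_le z x).trans
        (mul_le_mul_of_nonneg_left (norm_sub_le_of_mem_segment hz) h.pos.le))
      (left_mem_segment ℝ x y) (right_mem_segment ℝ x y)
  rw [Real.norm_eq_abs] at h1
  linarith [h1]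

theorem le_perturbedForm (h : IsSmallPerturbation A q c) (x : E) :
    c / 2 * ‖x‖ ^ 2 ≤ perturbedForm A q x := by
  have h1 := h.coercive x
  have h2 := (_root_.abs_le.1 (h.abs_le x)).1
  rw [perturbedForm]
  linarith

theorem perturbedForm_nonneg (h : IsSmallPerturbation A q c) (x : E) : 0 ≤ perturbedForm A q x :=
  le_trans (by have := h.pos; positivity) (h.le_perturbedForm x)

theorem perturbedForm_pos (h : IsSmallPerturbation A q c) {x : E} (hx : x ≠ 0) :
    0 < perturbedForm A q x :=
  lt_of_lt_of_le (by have := h.pos; have := norm_pos_iff.2 hx; positivity) (h.le_perturbedForm x)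

theorem perturbedForm_smul (h : IsSmallPerturbation A q c) (t : ℝ) (x : E) :
    perturbedForm A q (t • x) = t ^ 2 * perturbedForm A q x := by
  simp only [perturbedForm, h.homogeneous, map_smul, real_inner_smul_left, real_inner_smul_right]
  ring

theorem sqrt_perturbedForm_smul (h : IsSmallPerturbation A q c) (t : ℝ) (x : E) :
    √(perturbedForm A q (t • x)) = |t| * √(perturbedForm A q x) := by
  rw [h.perturbedForm_smul, Real.sqrt_mul (sq_nonneg t), Real.sqrt_sq_eq_abs]

variable [CompleteSpace E]

theorem inner_gradient (x y : E) : ⟪gradient q x, y⟫ = fderiv ℝ q x y := by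
  simp [gradient, InnerProductSpace.toDual_symm_apply]

theorem norm_gradient_sub_le (h : IsSmallPerturbation A q c) (x y : E) :
    ‖gradient q x - gradient q y‖ ≤ c * ‖x - y‖ := by
  rw [gradient, gradient, ← map_sub, LinearIsometryEquiv.norm_map]
  exact h.norm_fderiv_sub_le x y

theorem halfGradient_smul (h : IsSmallPerturbation A q c) (t : ℝ) (x : E) :
    halfGradient A q (t • x) = t • halfGradient A q x := by
  rcases eq_or_ne t 0 with rfl | ht
  · simp [halfGradient, gradient, h.fderiv_zero]
  · simp [halfGradient, gradient, h.fderiv_smul_of_ne_zero ht, smul_add, smul_comm t]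

theorem inner_halfGradient_self (h : IsSmallPerturbation A q c) (x : E) :
    ⟪halfGradient A q x, x⟫ = perturbedForm A q x := by
  have h1 := fderiv_apply_self_of_homogeneous (k := 2) (h.differentiable x).hasFDerivAt
    (fun t _ => by rw [h.homogeneous, smul_eq_mul])
  rw [halfGradient, inner_add_left, real_inner_smul_left, inner_gradient, h1, perturbedForm]
  simp

/-- The Fenchel inequality for `½ (⟨A x, x⟩ + q x)`, which is its convexity. -/
theorem two_mul_inner_halfGradient_le (h : IsSmallPerturbation A q c) (x y : E) :
    2 * ⟪halfGradient A q x, y⟫ ≤ perturbedForm A q x + perturbedForm A q y := by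
  have h1 := h.inner_halfGradient_self x
  have h2 := (_root_.abs_le.1 (h.abs_sub_sub_fderiv_le x y)).1
  have h3 := h.coercive (y - x)
  have h4 : ⟪halfGradient A q x, y - x⟫ = ⟪A x, y - x⟫ + 1 / 2 * fderiv ℝ q x (y - x) := by
    rw [halfGradient, inner_add_left, real_inner_smul_left, inner_gradient]
  have h5 : ⟪A y, x⟫ = ⟪A x, y⟫ := by rw [h.symm, real_inner_comm]
  simp only [perturbedForm, map_sub, inner_sub_left, inner_sub_right] at *
  linarith

/-- The Cauchy-Schwarz inequality for the norm `√(⟨A x, x⟩ + q x)`. -/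
theorem inner_halfGradient_le (h : IsSmallPerturbation A q c) (x y : E) :
    ⟪halfGradient A q x, y⟫ ≤ √(perturbedForm A q x) * √(perturbedForm A q y) := by
  rcases eq_or_ne x 0 with rfl | hx
  · have : halfGradient A q (0 : E) = 0 := by simpa using h.halfGradient_smul 0 0
    rw [this, inner_zero_left]
    positivity
  rcases eq_or_ne y 0 with rfl | hy
  · rw [inner_zero_right]
    positivity
  set a := √(perturbedForm A q x) with ha
  set b := √(perturbedForm A q y) with hb
  have ha0 : 0 < a := Real.sqrt_pos.2 (h.perturbedForm_pos hx)
  have hb0 : 0 < b := Real.sqrt_pos.2 (h.perturbedForm_pos hy)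
  -- normalise both vectors and use the Fenchel inequality
  have h1 := h.two_mul_inner_halfGradient_le (a⁻¹ • x) (b⁻¹ • y)
  rw [h.halfGradient_smul, h.perturbedForm_smul, h.perturbedForm_smul, real_inner_smul_left,
    real_inner_smul_right, ← Real.sq_sqrt (h.perturbedForm_nonneg x),
    ← Real.sq_sqrt (h.perturbedForm_nonneg y), ← ha, ← hb] at h1
  have h2 : a⁻¹ ^ 2 * a ^ 2 = 1 := by field_simp
  have h3 : b⁻¹ ^ 2 * b ^ 2 = 1 := by field_simp
  rw [h2, h3] at h1
  have h4 : a⁻¹ * (b⁻¹ * ⟪halfGradient A q x, y⟫) ≤ 1 := by linarith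
  calc ⟪halfGradient A q x, y⟫ = a * b * (a⁻¹ * (b⁻¹ * ⟪halfGradient A q x, y⟫)) := by
        field_simp
    _ ≤ a * b * 1 := by gcongr
    _ = a * b := mul_one _

theorem sqrt_perturbedForm_add_le (h : IsSmallPerturbation A q c) (x y : E) :
    √(perturbedForm A q (x + y)) ≤ √(perturbedForm A q x) + √(perturbedForm A q y) := by
  rcases eq_or_ne (x + y) 0 with h0 | h0
  · have : perturbedForm A q (x + y) = 0 := by
      rw [h0]; simp [perturbedForm, h.map_zero]
    rw [this, Real.sqrt_zero]
    positivity
  have h1 : 0 < √(perturbedForm A q (x + y)) := Real.sqrt_pos.2 (h.perturbedForm_pos h0)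
  have h2 := h.inner_halfGradient_self (x + y)
  rw [inner_add_right, ← Real.sq_sqrt (h.perturbedForm_nonneg (x + y))] at h2
  nlinarith [h.inner_halfGradient_le (x + y) x, h.inner_halfGradient_le (x + y) y]

theorem le_inner_halfGradient_sub (h : IsSmallPerturbation A q c) (x y : E) :
    c / 2 * ‖x - y‖ ^ 2 ≤ ⟪halfGradient A q x - halfGradient A q y, x - y⟫ := by
  have h1 : halfGradient A q x - halfGradient A q y
      = A (x - y) + (1 / 2 : ℝ) • (gradient q x - gradient q y) := by
    simp only [halfGradient, map_sub, smul_sub]; abel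
  have h2 := h.coercive (x - y)
  have h3 := (_root_.abs_le.1 ((abs_real_inner_le_norm (gradient q x - gradient q y) (x - y)).trans
    (mul_le_mul_of_nonneg_right (h.norm_gradient_sub_le x y) (norm_nonneg _)))).1
  rw [h1, inner_add_left, real_inner_smul_left]
  nlinarith

theorem norm_halfGradient_sub_le (h : IsSmallPerturbation A q c) (x y : E) :
    ‖halfGradient A q x - halfGradient A q y‖ ≤ (‖A‖ + c) * ‖x - y‖ := by
  have h1 : halfGradient A q x - halfGradient A q y
      = A (x - y) + (1 / 2 : ℝ) • (gradient q x - gradient q y) := by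
    simp only [halfGradient, map_sub, smul_sub]; abel
  rw [h1]
  refine (norm_add_le _ _).trans ?_
  rw [norm_smul]
  have h2 := A.le_opNorm (x - y)
  have h3 := h.norm_gradient_sub_le x y
  have h4 : ‖(1 / 2 : ℝ)‖ = 1 / 2 := by norm_num
  rw [h4]
  nlinarith [norm_nonneg (gradient q x - gradient q y)]

theorem contDiffAt_halfGradient (h : IsSmallPerturbation A q c) {x : E} (hx : x ≠ 0) :
    ContDiffAt ℝ ∞ (halfGradient A q) x := by
  have h1 : ContDiffAt ℝ ∞ (gradient q) x :=
    (InnerProductSpace.toDual ℝ E).symm.contDiff.contDiffAt.comp x (h.contDiffAt_fderiv hx)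
  exact A.contDiff.contDiffAt.add (contDiffAt_const.smul h1)

/-- Strong monotonicity of `halfGradient A q` passes to its derivative. -/
theorem le_inner_fderiv_halfGradient (h : IsSmallPerturbation A q c) {x : E} (hx : x ≠ 0)
    (y : E) : c / 2 * ‖y‖ ^ 2 ≤ ⟪fderiv ℝ (halfGradient A q) x y, y⟫ := by
  have h1 : HasFDerivAt (fun z => (InnerProductSpace.toDual ℝ E).symm (fderiv ℝ q z))
      ((InnerProductSpace.toDual ℝ E).symm.toContinuousLinearEquiv.toContinuousLinearMap.comp
        (fderiv ℝ (fderiv ℝ q) x)) x :=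
    (InnerProductSpace.toDual ℝ E).symm.toContinuousLinearEquiv.toContinuousLinearMap.hasFDerivAt.comp
      x (h.hasFDerivAt_fderiv hx)
  have h2 := (A.hasFDerivAt (x := x)).add (h1.const_smul (1 / 2 : ℝ))
  have h3 : fderiv ℝ (halfGradient A q) x y
      = A y + (1 / 2 : ℝ) • (InnerProductSpace.toDual ℝ E).symm (fderiv ℝ (fderiv ℝ q) x y) :=
    congrArg (fun L : E →L[ℝ] E => L y) (HasFDerivAt.fderiv (f := halfGradient A q) h2)
  rw [h3, inner_add_left, real_inner_smul_left, InnerProductSpace.toDual_symm_apply]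
  have h4 := (_root_.abs_le.1 ((fderiv ℝ (fderiv ℝ q) x).le_opNorm₂ y y)).1
  have h5 := h.hessian_le x hx
  have h6 : ‖fderiv ℝ (fderiv ℝ q) x‖ * ‖y‖ * ‖y‖ ≤ c * ‖y‖ * ‖y‖ := by gcongr
  nlinarith [h.coercive y]

theorem halfGradient_injective (h : IsSmallPerturbation A q c) :
    Function.Injective (halfGradient A q) := fun x y hxy => by
  have h1 := h.le_inner_halfGradient_sub x y
  rw [hxy, sub_self, inner_zero_left] at h1
  have h2 : ‖x - y‖ ^ 2 ≤ 0 := by nlinarith [h.pos]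
  have h3 : ‖x - y‖ = 0 := by nlinarith [norm_nonneg (x - y)]
  exact sub_eq_zero.1 (norm_eq_zero.1 h3)

theorem hasFDerivAt_perturbedForm (h : IsSmallPerturbation A q c) (x : E) :
    HasFDerivAt (perturbedForm A q) ((2 : ℝ) • InnerProductSpace.toDual ℝ E (halfGradient A q x))
      x := by
  have h1 := ((A.hasFDerivAt (x := x)).inner ℝ (hasFDerivAt_id x)).add
    (h.differentiable x).hasFDerivAt
  refine h1.congr_fderiv ?_
  ext y
  have h5 : ⟪A y, x⟫ = ⟪A x, y⟫ := by rw [h.symm, real_inner_comm]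
  simp only [add_apply, ContinuousLinearMap.comp_apply,
    ContinuousLinearMap.prod_apply, fderivInnerCLM_apply, smul_apply,
    InnerProductSpace.toDual_apply_apply, halfGradient, inner_add_left, real_inner_smul_left,
    inner_gradient, ContinuousLinearMap.id_apply, id, smul_eq_mul, h5]
  ring

theorem continuous_halfGradient (h : IsSmallPerturbation A q c) : Continuous (halfGradient A q) :=
  (LipschitzWith.of_dist_le' (K := ‖A‖ + c) fun x y => by
    rw [dist_eq_norm, dist_eq_norm]; exact h.norm_halfGradient_sub_le x y).continuous

variable [FiniteDimensional ℝ E]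

/-- `halfGradient A q` is onto: the coercive function `½ (⟨A y, y⟩ + q y) - ⟨x, y⟩` of `y` has a
minimiser. -/
theorem halfGradient_surjective (h : IsSmallPerturbation A q c) :
    Function.Surjective (halfGradient A q) := fun x => by
  have hd : ∀ y, HasFDerivAt (fun y => perturbedForm A q y - (2 : ℝ) * ⟪x, y⟫)
      ((2 : ℝ) • InnerProductSpace.toDual ℝ E (halfGradient A q y)
        - (2 : ℝ) • InnerProductSpace.toDual ℝ E x) y := fun y =>
    (h.hasFDerivAt_perturbedForm y).sub
      (((InnerProductSpace.toDual ℝ E x).hasFDerivAt (x := y)).const_smul (2 : ℝ))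
  have hlow : ∀ y, c / 2 * ‖y‖ ^ 2 - 2 * ‖x‖ * ‖y‖
      ≤ perturbedForm A q y - (2 : ℝ) * ⟪x, y⟫ := fun y => by
    have := h.le_perturbedForm y
    have := real_inner_le_norm x y
    linarith
  have ht : Tendsto (fun y => perturbedForm A q y - (2 : ℝ) * ⟪x, y⟫) (cocompact E) atTop := by
    refine tendsto_atTop_mono hlow ?_
    have h1 : Tendsto (fun s : ℝ => s * (c / 2 * s - 2 * ‖x‖)) atTop atTop := by
      refine tendsto_id.atTop_mul_atTop₀ ?_
      exact tendsto_atTop_add_const_right _ _ (tendsto_id.const_mul_atTop (by linarith [h.pos]))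
    refine (h1.comp (tendsto_norm_cocompact_atTop (E := E))).congr fun y => ?_
    simp only [Function.comp]
    ring
  obtain ⟨y, hy⟩ := (continuous_iff_continuousAt.2 fun y => (hd y).continuousAt).exists_forall_le ht
  have h0 := IsLocalMin.hasFDerivAt_eq_zero (Eventually.of_forall hy) (hd y)
  refine ⟨y, ?_⟩
  rw [← smul_sub, ← map_sub, smul_eq_zero] at h0
  rcases h0 with h0 | h0
  · norm_num at h0
  · exact sub_eq_zero.1 ((LinearIsometryEquiv.map_eq_zero_iff _).1 h0)

/-- The inverse of `halfGradient A q`. -/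
noncomputable def gradientInverse (h : IsSmallPerturbation A q c) : E → E :=
  (Equiv.ofBijective _ ⟨h.halfGradient_injective, h.halfGradient_surjective⟩).symm

theorem halfGradient_gradientInverse (h : IsSmallPerturbation A q c) (x : E) :
    halfGradient A q (h.gradientInverse x) = x :=
  (Equiv.ofBijective _ ⟨h.halfGradient_injective, h.halfGradient_surjective⟩).apply_symm_apply x

theorem gradientInverse_halfGradient (h : IsSmallPerturbation A q c) (x : E) :
    h.gradientInverse (halfGradient A q x) = x :=
  (Equiv.ofBijective _ ⟨h.halfGradient_injective, h.halfGradient_surjective⟩).symm_apply_apply x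

theorem le_inner_gradientInverse_sub (h : IsSmallPerturbation A q c) (x y : E) :
    c / 2 * ‖h.gradientInverse x - h.gradientInverse y‖ ^ 2
      ≤ ⟪x - y, h.gradientInverse x - h.gradientInverse y⟫ := by
  simpa only [h.halfGradient_gradientInverse] using
    h.le_inner_halfGradient_sub (h.gradientInverse x) (h.gradientInverse y)

theorem continuous_gradientInverse (h : IsSmallPerturbation A q c) :
    Continuous h.gradientInverse := by
  refine (LipschitzWith.of_dist_le' (K := 2 / c) fun x y => ?_).continuous
  rw [dist_eq_norm, dist_eq_norm]
  have h1 := (h.le_inner_gradientInverse_sub x y).trans (real_inner_le_norm _ _)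
  rcases (norm_nonneg (h.gradientInverse x - h.gradientInverse y)).eq_or_lt with h0 | h0
  · have := h.pos
    rw [← h0]; positivity
  · rw [div_mul_eq_mul_div, le_div_iff₀ h.pos]
    nlinarith

theorem gradientInverse_ne_zero (h : IsSmallPerturbation A q c) {x : E} (hx : x ≠ 0) :
    h.gradientInverse x ≠ 0 := fun h0 => hx (by
  have h1 := h.halfGradient_gradientInverse x
  rw [h0] at h1
  rw [← h1]
  simpa using h.halfGradient_smul 0 0)

theorem contDiffAt_gradientInverse (h : IsSmallPerturbation A q c) {x : E} (hx : x ≠ 0) :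
    ContDiffAt ℝ ∞ h.gradientInverse x := by
  let e : E ≃ₜ E :=
    { Equiv.ofBijective _ ⟨h.halfGradient_injective, h.halfGradient_surjective⟩ with
      continuous_toFun := h.continuous_halfGradient
      continuous_invFun := h.continuous_gradientInverse }
  have hy := h.gradientInverse_ne_zero hx
  set y := h.gradientInverse x with hydef
  have hinj : Function.Injective (fderiv ℝ (halfGradient A q) y : E →ₗ[ℝ] E) := by
    refine (injective_iff_map_eq_zero _).2 fun z hz => ?_
    have h1 := h.le_inner_fderiv_halfGradient hy z
    rw [show fderiv ℝ (halfGradient A q) y z = 0 from hz, inner_zero_left] at h1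
    have h2 : ‖z‖ ^ 2 ≤ 0 := by nlinarith [h.pos]
    exact norm_eq_zero.1 (by nlinarith [norm_nonneg z])
  let L : E ≃L[ℝ] E := (LinearEquiv.ofInjectiveEndo _ hinj).toContinuousLinearEquiv
  have hL : (L : E →L[ℝ] E) = fderiv ℝ (halfGradient A q) y := by ext z; rfl
  have hcd := h.contDiffAt_halfGradient hy
  refine e.toOpenPartialHomeomorph.contDiffAt_symm (f₀' := L) (a := x) (n := ∞) (by simp) ?_ hcd
  rw [hL]
  exact (hcd.differentiableAt (by simp)).hasFDerivAt

/-- Strong monotonicity of the inverse gradient, in infinitesimal form. -/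
theorem le_inner_fderiv_gradientInverse (h : IsSmallPerturbation A q c) {x : E} (hx : x ≠ 0)
    (y : E) : c / 2 / (‖A‖ + c) ^ 2 * ‖y‖ ^ 2 ≤ ⟪y, fderiv ℝ h.gradientInverse x y⟫ := by
  have hy := h.gradientInverse_ne_zero hx
  have h1 : HasFDerivAt h.gradientInverse (fderiv ℝ h.gradientInverse x) x :=
    ((h.contDiffAt_gradientInverse hx).differentiableAt (by simp)).hasFDerivAt
  have h2 : HasFDerivAt (halfGradient A q) (fderiv ℝ (halfGradient A q) (h.gradientInverse x))
      (h.gradientInverse x) :=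
    ((h.contDiffAt_halfGradient hy).differentiableAt (by simp)).hasFDerivAt
  have h3 := h2.comp x h1
  have h4 : halfGradient A q ∘ h.gradientInverse = id := by
    ext1 z; exact h.halfGradient_gradientInverse z
  rw [h4] at h3
  set z := fderiv ℝ h.gradientInverse x y with hz
  have h5 : fderiv ℝ (halfGradient A q) (h.gradientInverse x) z = y :=
    congrArg (fun L : E →L[ℝ] E => L y) (h3.unique (hasFDerivAt_id x))
  have h6 := h.le_inner_fderiv_halfGradient hy z
  rw [h5] at h6
  have hpos : 0 < ‖A‖ + c := by have := h.pos; positivity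
  have h7 : ‖y‖ ≤ (‖A‖ + c) * ‖z‖ := by
    rw [← h5]
    refine ContinuousLinearMap.le_of_opNorm_le _ ?_ z
    refine h2.le_of_lip' hpos.le (Eventually.of_forall fun w => ?_)
    exact h.norm_halfGradient_sub_le w _
  have h8 : ‖y‖ ^ 2 ≤ (‖A‖ + c) ^ 2 * ‖z‖ ^ 2 := by
    rw [← mul_pow]; gcongr
  refine le_trans ?_ h6
  rw [div_mul_eq_mul_div, div_le_iff₀ (by positivity)]
  nlinarith [h.pos]

end IsSmallPerturbation

end SmallPerturbation

/-! ### Functions that are positively homogeneous of degree one -/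

theorem recession_eq_self {f : Mat → ℝ} (hf : ∀ (t : ℝ) (ξ : Mat), 0 < t → f (t • ξ) = t * f ξ) :
    recession f = f := by
  ext ξ
  refine Tendsto.limUnder_eq (tendsto_const_nhds.congr' ?_)
  filter_upwards [eventually_gt_atTop 0] with t ht
  rw [hf t ξ ht, mul_div_cancel_left₀ _ ht.ne']

theorem secondDeriv_eq_zero_of_homogeneous {f : Mat → ℝ}
    (hf : ∀ (t : ℝ) (ξ : Mat), 0 < t → f (t • ξ) = t * f ξ) (hsm : ContDiffOn ℝ ∞ f {0}ᶜ)
    {s : ℝ} (hs : 0 < s) {u : Mat} (hu : u ≠ 0) : secondDeriv f (s • u) u = 0 := by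
  have hx : s • u ≠ 0 := smul_ne_zero hs.ne' hu
  have h1 : HasFDerivAt (fderiv ℝ f) (fderiv ℝ (fderiv ℝ f) (s • u)) (s • u) :=
    (((hsm.contDiffAt (isOpen_compl_singleton.mem_nhds hx)).fderiv_right (m := ∞)
      (by simp)).differentiableAt (by simp)).hasFDerivAt
  have h2 := fderiv_apply_self_of_homogeneous (k := 0) h1 fun t ht => by
    have h3 : fderiv ℝ (fun x => f (t • x)) (s • u) = t • fderiv ℝ f (t • s • u) :=
      fderiv_comp_smul t
    have h4 : (fun x => f (t • x)) = t • f := by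
      ext y; simp [hf t y ht]
    rw [h4, fderiv_const_smul_field] at h3
    rw [pow_zero, one_smul]
    exact (smul_right_injective _ ht.ne' h3).symm
  rw [Nat.cast_zero, zero_smul, map_smul, smul_eq_zero] at h2
  rw [secondDeriv, h2.resolve_left hs.ne']
  rfl

namespace IsSmallPerturbation

variable {A : Mat →L[ℝ] Mat} {q : Mat → ℝ} {c : ℝ}

/-! ### The dual of a perturbed quadratic norm -/

theorem isNorm_sqrt (h : IsSmallPerturbation A q c) :
    IsNorm fun x => √(perturbedForm A q x) where
  smul := h.sqrt_perturbedForm_smul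
  add_le := h.sqrt_perturbedForm_add_le
  eq_zero x hx := by
    by_contra h0
    exact (Real.sqrt_pos.2 (h.perturbedForm_pos h0)).ne' hx

theorem inner_le (h : IsSmallPerturbation A q c) (x y : Mat) :
    ⟪x, y⟫ ≤ √(perturbedForm A q (h.gradientInverse x)) * √(perturbedForm A q y) := by
  simpa only [h.halfGradient_gradientInverse] using
    h.inner_halfGradient_le (h.gradientInverse x) y

theorem inner_gradientInverse (h : IsSmallPerturbation A q c) (x : Mat) :
    ⟪x, h.gradientInverse x⟫ = perturbedForm A q (h.gradientInverse x) := by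
  simpa only [h.halfGradient_gradientInverse] using
    h.inner_halfGradient_self (h.gradientInverse x)

/-- The supremum is attained at the normalised preimage of `x` under the half gradient. -/
theorem dualNorm_eq (h : IsSmallPerturbation A q c) (x : Mat) :
    dualNorm (fun y => √(perturbedForm A q y)) x
      = √(perturbedForm A q (h.gradientInverse x)) := by
  refine IsGreatest.csSup_eq ⟨?_, ?_⟩
  · rcases eq_or_ne x 0 with rfl | hx
    · refine ⟨0, ?_, ?_⟩
      · simp [perturbedForm, h.map_zero]
      · have h1 := h.inner_gradientInverse 0
        rw [inner_zero_left] at h1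
        rw [← h1]
        simp
    · have h0 : 0 < √(perturbedForm A q (h.gradientInverse x)) :=
        Real.sqrt_pos.2 (h.perturbedForm_pos (h.gradientInverse_ne_zero hx))
      refine ⟨(√(perturbedForm A q (h.gradientInverse x)))⁻¹ • h.gradientInverse x, ?_, ?_⟩
      · change √(perturbedForm A q (_ • _)) ≤ 1
        rw [h.sqrt_perturbedForm_smul, abs_of_pos (inv_pos.2 h0),
          inv_mul_cancel₀ h0.ne']
      · simp only [real_inner_smul_right, h.inner_gradientInverse]
        nth_rewrite 2 [← Real.sq_sqrt (h.perturbedForm_nonneg (h.gradientInverse x))]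
        field_simp
  · rintro _ ⟨y, hy, rfl⟩
    refine (h.inner_le x y).trans ?_
    exact mul_le_of_le_one_right (Real.sqrt_nonneg _) hy

theorem inner_le_dualNorm (h : IsSmallPerturbation A q c) (x y : Mat) :
    ⟪x, y⟫ ≤ dualNorm (fun y => √(perturbedForm A q y)) x * √(perturbedForm A q y) := by
  rw [h.dualNorm_eq]
  exact h.inner_le x y

theorem dualNorm_nonneg (h : IsSmallPerturbation A q c) (x : Mat) :
    0 ≤ dualNorm (fun y => √(perturbedForm A q y)) x := by
  rw [h.dualNorm_eq]
  exact Real.sqrt_nonneg _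

theorem dualNorm_sq (h : IsSmallPerturbation A q c) (x : Mat) :
    dualNorm (fun y => √(perturbedForm A q y)) x ^ 2 = ⟪x, h.gradientInverse x⟫ := by
  rw [h.dualNorm_eq, Real.sq_sqrt (h.perturbedForm_nonneg _), h.inner_gradientInverse]

theorem dualNorm_pos (h : IsSmallPerturbation A q c) {x : Mat} (hx : x ≠ 0) :
    0 < dualNorm (fun y => √(perturbedForm A q y)) x := by
  rw [h.dualNorm_eq]
  exact Real.sqrt_pos.2 (h.perturbedForm_pos (h.gradientInverse_ne_zero hx))

theorem gradientInverse_smul (h : IsSmallPerturbation A q c) (t : ℝ) (x : Mat) :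
    h.gradientInverse (t • x) = t • h.gradientInverse x := by
  apply h.halfGradient_injective
  rw [h.halfGradient_smul, h.halfGradient_gradientInverse, h.halfGradient_gradientInverse]

theorem isNorm_dualNorm (h : IsSmallPerturbation A q c) :
    IsNorm (dualNorm fun y => √(perturbedForm A q y)) where
  smul t x := by
    rw [h.dualNorm_eq, h.dualNorm_eq, h.gradientInverse_smul, h.sqrt_perturbedForm_smul]
  add_le x y := by
    rcases eq_or_ne (x + y) 0 with h0 | h0
    · have h1 := h.dualNorm_sq (x + y)
      rw [h0, inner_zero_left, sq_eq_zero_iff] at h1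
      rw [h0, h1]
      exact add_nonneg (h.dualNorm_nonneg x) (h.dualNorm_nonneg y)
    · have h1 : 0 < √(perturbedForm A q (h.gradientInverse (x + y))) :=
        Real.sqrt_pos.2 (h.perturbedForm_pos (h.gradientInverse_ne_zero h0))
      have h2 := h.dualNorm_sq (x + y)
      rw [inner_add_left, pow_two] at h2
      nth_rewrite 2 [h.dualNorm_eq] at h2
      have h3 := h.inner_le_dualNorm x (h.gradientInverse (x + y))
      have h4 := h.inner_le_dualNorm y (h.gradientInverse (x + y))
      exact le_of_mul_le_mul_right (by linarith) h1
  eq_zero x hx := by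
    by_contra h0
    exact (h.dualNorm_pos h0).ne' hx

theorem contDiffAt_dualNorm_sq (h : IsSmallPerturbation A q c) {x : Mat} (hx : x ≠ 0) :
    ContDiffAt ℝ ∞ (fun x => dualNorm (fun y => √(perturbedForm A q y)) x ^ 2) x := by
  simp_rw [h.dualNorm_sq]
  exact contDiffAt_id.inner ℝ (h.contDiffAt_gradientInverse hx)

theorem contDiffAt_dualNorm (h : IsSmallPerturbation A q c) {x : Mat} (hx : x ≠ 0) :
    ContDiffAt ℝ ∞ (dualNorm fun y => √(perturbedForm A q y)) x := by
  have h1 := (h.contDiffAt_dualNorm_sq hx).sqrt (pow_pos (h.dualNorm_pos hx) 2).ne'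
  simp_rw [Real.sqrt_sq (h.dualNorm_nonneg _)] at h1
  exact h1

/-- Half the square of the dual norm is the convex conjugate of `½ (⟨A x, x⟩ + q x)`, so its
gradient inverts that of the latter. -/
theorem hasFDerivAt_dualNorm_sq (h : IsSmallPerturbation A q c) {x : Mat} (hx : x ≠ 0) :
    HasFDerivAt (fun x => dualNorm (fun y => √(perturbedForm A q y)) x ^ 2)
      ((2 : ℝ) • InnerProductSpace.toDual ℝ Mat (h.gradientInverse x)) x := by
  have h1 := ((h.contDiffAt_dualNorm_sq hx).differentiableAt (by simp)).hasFDerivAt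
  set y := h.gradientInverse x with hy
  have h2 := h1.sub (((InnerProductSpace.toDual ℝ Mat y).hasFDerivAt (x := x)).const_smul (2 : ℝ))
  have hmin : IsLocalMin ((fun x => dualNorm (fun y => √(perturbedForm A q y)) x ^ 2)
      - (2 : ℝ) • ⇑(InnerProductSpace.toDual ℝ Mat y)) x := by
    refine Eventually.of_forall fun z => ?_
    simp only [Pi.sub_apply, Pi.smul_apply, InnerProductSpace.toDual_apply_apply, smul_eq_mul]
    have h3 := h.inner_le_dualNorm z y
    have h4 := Real.sq_sqrt (h.perturbedForm_nonneg y)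
    have h5 := h.inner_gradientInverse x
    rw [h.dualNorm_sq x, ← hy, real_inner_comm x y, h5, real_inner_comm z y]
    nlinarith [sq_nonneg (dualNorm (fun y => √(perturbedForm A q y)) z - √(perturbedForm A q y))]
  rw [← sub_eq_zero.1 (hmin.hasFDerivAt_eq_zero h2)]
  exact h1

theorem hasGradientAt_dualNorm (h : IsSmallPerturbation A q c) {x : Mat} (hx : x ≠ 0) :
    HasGradientAt (dualNorm fun y => √(perturbedForm A q y))
      ((dualNorm (fun y => √(perturbedForm A q y)) x)⁻¹ • h.gradientInverse x) x := by
  have h1 := (h.hasFDerivAt_dualNorm_sq hx).sqrt (pow_pos (h.dualNorm_pos hx) 2).ne'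
  simp_rw [Real.sqrt_sq (h.dualNorm_nonneg _)] at h1
  rw [hasGradientAt_iff_hasFDerivAt]
  refine h1.congr_fderiv ?_
  rw [map_smul, smul_smul]
  congr 1
  have := (h.dualNorm_pos hx).ne'
  field_simp

theorem le_secondDeriv_dualNorm_sq (h : IsSmallPerturbation A q c) {x : Mat} (hx : x ≠ 0)
    (y : Mat) : 2 * (c / 2 / (‖A‖ + c) ^ 2) * ‖y‖ ^ 2 ≤
      secondDeriv (fun x => dualNorm (fun y => √(perturbedForm A q y)) x ^ 2) x y := by
  have h1 : fderiv ℝ (fun x => dualNorm (fun y => √(perturbedForm A q y)) x ^ 2)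
      =ᶠ[𝓝 x] fun x => (2 : ℝ) • InnerProductSpace.toDual ℝ Mat (h.gradientInverse x) := by
    filter_upwards [isOpen_compl_singleton.mem_nhds hx] with z hz
    exact (h.hasFDerivAt_dualNorm_sq hz).fderiv
  have h2 : HasFDerivAt h.gradientInverse (fderiv ℝ h.gradientInverse x) x :=
    ((h.contDiffAt_gradientInverse hx).differentiableAt (by simp)).hasFDerivAt
  have h3 := (((InnerProductSpace.toDual ℝ Mat).toContinuousLinearEquiv.toContinuousLinearMap
    |>.hasFDerivAt).comp x h2).const_smul (2 : ℝ)
  have h4 : fderiv ℝ (fderiv ℝ fun x => dualNorm (fun y => √(perturbedForm A q y)) x ^ 2) x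
      = _ := h1.fderiv_eq.trans h3.fderiv
  have h5 := h.le_inner_fderiv_gradientInverse hx y
  rw [secondDeriv, h4]
  change _ ≤ 2 * ⟪fderiv ℝ h.gradientInverse x y, y⟫
  rw [real_inner_comm]
  linarith

theorem norm_le_dualNorm (h : IsSmallPerturbation A q c) (x : Mat) :
    ‖x‖ ≤ √(‖A‖ + c) * dualNorm (fun y => √(perturbedForm A q y)) x := by
  have hpos := h.pos
  rcases eq_or_ne x 0 with rfl | hx
  · rw [norm_zero]
    exact mul_nonneg (Real.sqrt_nonneg _) (h.dualNorm_nonneg _)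
  have h1 : √(perturbedForm A q x) ≤ √(‖A‖ + c) * ‖x‖ := by
    rw [← Real.sqrt_sq (norm_nonneg x), ← Real.sqrt_mul (by positivity)]
    refine Real.sqrt_le_sqrt ?_
    have h2 := (le_abs_self _).trans (h.abs_le x)
    have h3 := (real_inner_le_norm (A x) x).trans
      (mul_le_mul_of_nonneg_right (A.le_opNorm x) (norm_nonneg x))
    rw [perturbedForm]
    nlinarith [sq_nonneg ‖x‖]
  have h2 := h.inner_le_dualNorm x x
  rw [real_inner_self_eq_norm_sq] at h2
  have h3 := mul_le_mul_of_nonneg_left h1 (h.dualNorm_nonneg x)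
  have h4 := norm_pos_iff.2 hx
  nlinarith

theorem dualNorm_le_norm (h : IsSmallPerturbation A q c) (x : Mat) :
    dualNorm (fun y => √(perturbedForm A q y)) x ≤ √(2 / c) * ‖x‖ := by
  have hpos := h.pos
  have h1 := h.le_perturbedForm (h.gradientInverse x)
  have h2 := h.inner_gradientInverse x
  have h3 := real_inner_le_norm x (h.gradientInverse x)
  rw [← abs_of_nonneg (h.dualNorm_nonneg x), ← Real.sqrt_sq (norm_nonneg x),
    ← Real.sqrt_mul (by positivity), ← Real.sqrt_sq_eq_abs]
  refine Real.sqrt_le_sqrt ?_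
  rw [h.dualNorm_sq, div_mul_eq_mul_div, le_div_iff₀ hpos]
  have h4 : ‖x‖ * ‖h.gradientInverse x‖ * c ≤ 2 * ‖x‖ ^ 2 := by
    have h5 : c * ‖h.gradientInverse x‖ ≤ 2 * ‖x‖ := by
      rcases (norm_nonneg (h.gradientInverse x)).eq_or_lt with h0 | h0
      · rw [← h0]; simp
      · nlinarith
    nlinarith [norm_nonneg x]
  nlinarith

theorem admissibleIntegrand (h : IsSmallPerturbation A q c) :
    AdmissibleIntegrand (dualNorm fun y => √(perturbedForm A q y)) := by
  have hN := h.isNorm_dualNorm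
  have hhom : ∀ (t : ℝ) (ξ : Mat), 0 < t → dualNorm (fun y => √(perturbedForm A q y)) (t • ξ)
      = t * dualNorm (fun y => √(perturbedForm A q y)) ξ := fun t ξ ht => by
    rw [hN.smul, abs_of_pos ht]
  have hsm : ContDiffOn ℝ ∞ (dualNorm fun y => √(perturbedForm A q y)) {0}ᶜ := fun x hx =>
    (h.contDiffAt_dualNorm hx).contDiffWithinAt
  have hrec := recession_eq_self hhom
  have hpos := h.pos
  have two_le : (2 : WithTop ℕ∞) ≤ ∞ := WithTop.coe_le_coe.2 le_top
  refine ⟨⟨convex_univ, fun x _ y _ a b ha hb _ => ?_⟩, ?_, ⟨⟨1, one_pos, ?_⟩, ?_⟩, ?_, ?_, ?_, ?_⟩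
  · refine (hN.add_le _ _).trans ?_
    rw [hN.smul, hN.smul, abs_of_nonneg ha, abs_of_nonneg hb, smul_eq_mul, smul_eq_mul]
  · refine ⟨√(‖A‖ + c) + √(2 / c) + 1, by positivity, fun ξ => ?_⟩
    have h1 := h.norm_le_dualNorm ξ
    have h2 := h.dualNorm_le_norm ξ
    have h3 := h.dualNorm_nonneg ξ
    have h4 := Real.sqrt_nonneg (‖A‖ + c)
    have h5 := Real.sqrt_nonneg (2 / c)
    constructor
    · have h6 : (√(‖A‖ + c) + √(2 / c) + 1)⁻¹ * ‖ξ‖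
          ≤ dualNorm (fun y => √(perturbedForm A q y)) ξ := by
        rw [inv_mul_le_iff₀ (by positivity)]
        nlinarith
      linarith
    · nlinarith [norm_nonneg ξ]
  · refine (hsm.mono fun x hx => ?_).of_le two_le
    rintro rfl
    simp at hx
  · exact hsm.of_le (by exact_mod_cast le_top)
  · refine tendsto_const_nhds.congr' ?_
    filter_upwards [eventually_gt_atTop 0] with a ha
    refine (le_antisymm (iSup₂_le fun ξ hξ => ?_) bot_le).symm
    have hξ0 : 0 < ‖ξ‖ := ha.trans_le hξ
    have h1 : ∫⁻ s in Ioi ‖ξ‖, ENNReal.ofReal (secondDeriv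
        (dualNorm fun y => √(perturbedForm A q y)) (s • ‖ξ‖⁻¹ • ξ) (‖ξ‖⁻¹ • ξ)) = 0 := by
      rw [setLIntegral_congr_fun (g := fun _ => 0) measurableSet_Ioi fun s hs => ?_,
        lintegral_zero]
      simp only
      rw [secondDeriv_eq_zero_of_homogeneous hhom hsm (hξ0.trans hs)
        (smul_ne_zero (inv_ne_zero hξ0.ne') (norm_pos_iff.1 hξ0)), ENNReal.ofReal_zero]
    rw [h1, mul_zero]
    rfl
  · rw [hrec]
    exact hsm.of_le two_le
  · refine ⟨2 * (c / 2 / (‖A‖ + c) ^ 2), by positivity, fun ξ hξ η => ?_⟩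
    rw [hrec]
    exact h.le_secondDeriv_dualNorm_sq hξ η
  · intro ξ ξ' _ _ h1
    rw [hrec] at *
    exact h1

end IsSmallPerturbation

/-! ### Coordinates on the space of matrices -/

theorem tensor_apply (v w : Plane) (i j : Fin 2) : tensor v w (i, j) = v i * w j := rfl

theorem inner_eq_sum (x y : Mat) :
    ⟪x, y⟫ = x (0, 0) * y (0, 0) + x (0, 1) * y (0, 1) + x (1, 0) * y (1, 0)
      + x (1, 1) * y (1, 1) := by
  simp [PiLp.inner_apply, Fintype.sum_prod_type, Fin.sum_univ_two]
  ring

theorem norm_sq_eq_sum (x : Mat) :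
    ‖x‖ ^ 2 = x (0, 0) ^ 2 + x (0, 1) ^ 2 + x (1, 0) ^ 2 + x (1, 1) ^ 2 := by
  rw [← real_inner_self_eq_norm_sq, inner_eq_sum]
  ring

/-- The operator `A` as a continuous linear map. -/
noncomputable def quadOperator : Mat →L[ℝ] Mat :=
  LinearMap.toContinuousLinearMap
    { toFun := quadMap
      map_add' := fun x y => by
        simp only [quadMap, PiLp.add_apply, add_smul]
        abel
      map_smul' := fun t x => by
        simp only [quadMap, PiLp.smul_apply, smul_eq_mul, mul_smul, smul_add, RingHom.id_apply] }

theorem quadOperator_apply (x : Mat) : quadOperator x = quadMap x := rfl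

theorem quadMap_apply (x : Mat) :
    quadMap x (0, 0) = x (0, 0) ∧ quadMap x (0, 1) = 2 * x (0, 1) + x (1, 0) ∧
      quadMap x (1, 0) = x (1, 0) + x (0, 1) ∧ quadMap x (1, 1) = x (1, 1) := by
  refine ⟨?_, ?_, ?_, ?_⟩ <;> simp [quadMap, tensor_apply, basisVec]
  ring

theorem inner_quadMap (x y : Mat) :
    ⟪quadMap x, y⟫ = x (0, 0) * y (0, 0) + (2 * x (0, 1) + x (1, 0)) * y (0, 1)
      + (x (1, 0) + x (0, 1)) * y (1, 0) + x (1, 1) * y (1, 1) := by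
  obtain ⟨h1, h2, h3, h4⟩ := quadMap_apply x
  rw [inner_eq_sum, h1, h2, h3, h4]

theorem perturbedQuadratic_eq (η : Mat → ℝ) :
    perturbedQuadratic η = fun x => √(perturbedForm quadOperator (perturbation η) x) := rfl

/-! ### The cutoff function and the perturbation -/

/-- A bump around `e₁ ⊗ e₁`: equal to `1` within distance `10 ε` and to `0` beyond `20 ε`. -/
noncomputable def bump (ε : ℝ) (x : Mat) : ℝ :=
  Real.smoothTransition ((400 - ‖x - tensor (basisVec 0) (basisVec 0)‖ ^ 2 / ε ^ 2) / 300)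

/-- The cutoff around `±e₁ ⊗ e₁`. This form of the union of two bumps has values in `[0, 1]` even
where the bumps overlap. -/
noncomputable def cutoff (ε : ℝ) (x : Mat) : ℝ := 1 - (1 - bump ε x) * (1 - bump ε (-x))

theorem bump_eq_one {ε : ℝ} (hε : 0 < ε) {x : Mat}
    (hx : ‖x - tensor (basisVec 0) (basisVec 0)‖ ≤ 10 * ε) : bump ε x = 1 := by
  apply Real.smoothTransition.one_of_one_le
  have : ‖x - tensor (basisVec 0) (basisVec 0)‖ ^ 2 / ε ^ 2 ≤ 100 := by
    rw [div_le_iff₀ (by positivity)]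
    nlinarith [norm_nonneg (x - tensor (basisVec 0) (basisVec 0))]
  linarith

theorem bump_eq_zero {ε : ℝ} (hε : 0 < ε) {x : Mat}
    (hx : 400 * ε ^ 2 ≤ ‖x - tensor (basisVec 0) (basisVec 0)‖ ^ 2) : bump ε x = 0 := by
  apply Real.smoothTransition.zero_of_nonpos
  have : 400 ≤ ‖x - tensor (basisVec 0) (basisVec 0)‖ ^ 2 / ε ^ 2 := by
    rwa [le_div_iff₀ (by positivity)]
  linarith

theorem contDiff_bump (ε : ℝ) : ContDiff ℝ ∞ (bump ε) := by
  have h1 : ContDiff ℝ ∞ fun x : Mat =>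
      (400 - ‖x - tensor (basisVec 0) (basisVec 0)‖ ^ 2 / ε ^ 2) / 300 :=
    (contDiff_const.sub (((contDiff_id.sub contDiff_const).norm_sq ℝ).div_const _)).div_const _
  exact Real.smoothTransition.contDiff.comp h1

theorem cutoff_neg (ε : ℝ) (x : Mat) : cutoff ε (-x) = cutoff ε x := by
  rw [cutoff, cutoff, neg_neg, mul_comm]

theorem contDiff_cutoff (ε : ℝ) : ContDiff ℝ ∞ (cutoff ε) :=
  contDiff_const.sub ((contDiff_const.sub (contDiff_bump ε)).mul
    (contDiff_const.sub ((contDiff_bump ε).comp contDiff_neg)))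

theorem isCutoff_cutoff {ε : ℝ} (hε : 0 < ε) : IsCutoff ε (cutoff ε) where
  smooth := contDiff_cutoff ε
  even := cutoff_neg ε
  mem_Icc x := by
    have h1 := Real.smoothTransition.nonneg
      ((400 - ‖x - tensor (basisVec 0) (basisVec 0)‖ ^ 2 / ε ^ 2) / 300)
    have h2 := Real.smoothTransition.le_one
      ((400 - ‖x - tensor (basisVec 0) (basisVec 0)‖ ^ 2 / ε ^ 2) / 300)
    have h3 := Real.smoothTransition.nonneg
      ((400 - ‖-x - tensor (basisVec 0) (basisVec 0)‖ ^ 2 / ε ^ 2) / 300)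
    have h4 := Real.smoothTransition.le_one
      ((400 - ‖-x - tensor (basisVec 0) (basisVec 0)‖ ^ 2 / ε ^ 2) / 300)
    constructor <;> simp only [cutoff, bump] <;> nlinarith
  eq_one x hx := by rw [cutoff, bump_eq_one hε hx]; ring
  eq_zero x hx hx' := by
    rw [cutoff, bump_eq_zero hε (by nlinarith), bump_eq_zero hε]
    · ring
    · rw [← norm_neg, neg_sub, sub_neg_eq_add, add_comm]
      nlinarith

theorem norm_sq_inv_norm_smul_sub {x : Mat} (hx : x ≠ 0) :
    ‖‖x‖⁻¹ • x - tensor (basisVec 0) (basisVec 0)‖ ^ 2 = 2 - 2 * (x (0, 0) / ‖x‖) := by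
  have h0 := norm_pos_iff.2 hx
  have h1 := norm_sq_eq_sum x
  rw [norm_sq_eq_sum]
  simp [tensor_apply, basisVec]
  field_simp
  linarith

theorem norm_sq_neg_inv_norm_smul_sub {x : Mat} (hx : x ≠ 0) :
    ‖-(‖x‖⁻¹ • x) - tensor (basisVec 0) (basisVec 0)‖ ^ 2 = 2 + 2 * (x (0, 0) / ‖x‖) := by
  have h := norm_sq_inv_norm_smul_sub (neg_ne_zero.2 hx)
  rw [norm_neg, smul_neg] at h
  rw [h, PiLp.neg_apply, neg_div]
  ring

/-- The cutoff vanishes near the matrices whose first entry is zero, where `q` has a division by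
zero. -/
theorem cutoff_eq_zero {ε : ℝ} (hε : 0 < ε) (hε1 : ε ≤ 1 / 100) {x : Mat}
    (hx : 2 * |x (0, 0)| < ‖x‖) : cutoff ε (‖x‖⁻¹ • x) = 0 := by
  have h0 : 0 < ‖x‖ := lt_of_le_of_lt (by positivity) hx
  have hx0 : x ≠ 0 := norm_pos_iff.1 h0
  have h1 : |x (0, 0) / ‖x‖| ≤ 1 / 2 := by
    rw [abs_div, abs_norm, div_le_iff₀ h0]
    linarith
  have h2 := abs_le.1 h1
  rw [cutoff, bump_eq_zero hε, bump_eq_zero hε]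
  · ring
  · rw [norm_sq_neg_inv_norm_smul_sub hx0]; nlinarith [h2.1]
  · rw [norm_sq_inv_norm_smul_sub hx0]; nlinarith [h2.2]

theorem perturbation_smul {η : Mat → ℝ} (hη : ∀ x, η (-x) = η x) (t : ℝ) (x : Mat) :
    perturbation η (t • x) = t ^ 2 * perturbation η x := by
  rcases lt_trichotomy t 0 with ht | rfl | ht
  · have h1 : ‖t • x‖⁻¹ • t • x = -(‖x‖⁻¹ • x) := by
      rw [norm_smul, Real.norm_eq_abs, abs_of_neg ht, smul_smul, ← neg_smul]
      congr 1
      have := ht.ne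
      field_simp
    rw [perturbation, perturbation, h1, hη, norm_smul, mul_pow, Real.norm_eq_abs, sq_abs]
    simp only [PiLp.neg_apply, neg_sq, mul_neg, neg_div_neg_eq]
    ring
  · simp [perturbation]
  · have h1 : ‖t • x‖⁻¹ • t • x = ‖x‖⁻¹ • x := by
      rw [norm_smul, Real.norm_eq_abs, abs_of_pos ht, smul_smul]
      congr 1
      field_simp
    rw [perturbation, perturbation, h1, norm_smul, mul_pow, Real.norm_eq_abs, sq_abs]
    ring

theorem eventually_perturbation_eq_zero {ε : ℝ} (hε : 0 < ε) (hε1 : ε ≤ 1 / 100) {x : Mat}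
    (hx : x ≠ 0) (hx0 : x (0, 0) = 0) : perturbation (cutoff ε) =ᶠ[𝓝 x] fun _ => 0 := by
  have h1 : IsOpen {y : Mat | 2 * |y (0, 0)| < ‖y‖} := isOpen_lt (by fun_prop) (by fun_prop)
  filter_upwards [h1.mem_nhds (show 2 * |x (0, 0)| < ‖x‖ by simpa [hx0] using hx)] with y hy
  rw [perturbation, cutoff_eq_zero hε hε1 hy, zero_mul, mul_zero]

theorem contDiffOn_perturbation {ε : ℝ} (hε : 0 < ε) (hε1 : ε ≤ 1 / 100) :
    ContDiffOn ℝ ∞ (perturbation (cutoff ε)) {0}ᶜ := by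
  intro x hx
  apply ContDiffAt.contDiffWithinAt
  by_cases hx0 : x (0, 0) = 0
  · exact contDiffAt_const.congr_of_eventuallyEq (eventually_perturbation_eq_zero hε hε1 hx hx0)
  · have hn : ContDiffAt ℝ ∞ (fun x : Mat => ‖x‖) x := contDiffAt_norm ℝ hx
    have hu : ContDiffAt ℝ ∞ (fun x : Mat => ‖x‖⁻¹ • x) x :=
      (hn.inv (norm_ne_zero_iff.2 hx)).smul contDiffAt_id
    have hcoord : ∀ p, ContDiffAt ℝ ∞ (fun x : Mat => (‖x‖⁻¹ • x) p) x := fun p =>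
      (contDiffAt_piLp_apply 2).comp x hu
    refine (hn.pow 2).mul (((contDiff_cutoff ε).contDiffAt.comp x hu).mul
      (((contDiffAt_const.mul ((hcoord _).pow 2)).mul (hcoord _)).div (hcoord _) ?_))
    simpa using ⟨hx, hx0⟩

/-! ### The second derivative of the perturbation is small -/

/-- The perturbation for the cutoff parameter `s`, written in the variables in which the three
entries other than the first one are blown up by the factor `s⁻¹`. In these variables it is smooth
up to `s = 0`, which bounds its second derivative uniformly in `s`. -/
noncomputable def blowUp (p : ℝ × Mat) : ℝ :=
  2 * Real.smoothTransition ((400 - 2 * (p.2 (0, 1) ^ 2 + p.2 (1, 0) ^ 2 + p.2 (1, 1) ^ 2) /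
      (√(p.2 (0, 0) ^ 2 + p.1 ^ 2 * (p.2 (0, 1) ^ 2 + p.2 (1, 0) ^ 2 + p.2 (1, 1) ^ 2)) *
        (√(p.2 (0, 0) ^ 2 + p.1 ^ 2 * (p.2 (0, 1) ^ 2 + p.2 (1, 0) ^ 2 + p.2 (1, 1) ^ 2))
          + p.2 (0, 0)))) / 300)
    * p.2 (1, 0) ^ 2 * p.2 (1, 1) / p.2 (0, 0)

theorem contDiffAt_blowUp {p : ℝ × Mat} (hp : 0 < p.2 (0, 0)) : ContDiffAt ℝ ∞ blowUp p := by
  have hc : ∀ i, ContDiffAt ℝ ∞ (fun p : ℝ × Mat => p.2 i) p := fun i =>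
    (contDiffAt_piLp_apply 2).comp p contDiffAt_snd
  have hZ := (((hc (0, 1)).pow 2).add ((hc (1, 0)).pow 2)).add ((hc (1, 1)).pow 2)
  have h0 : 0 < p.2 (0, 0) ^ 2 + p.1 ^ 2 * (p.2 (0, 1) ^ 2 + p.2 (1, 0) ^ 2 + p.2 (1, 1) ^ 2) := by
    positivity
  have hn := (((hc (0, 0)).pow 2).add ((contDiffAt_fst.pow 2).mul hZ)).sqrt h0.ne'
  have hn0 := Real.sqrt_pos.2 h0
  have harg := (contDiffAt_const (c := (400 : ℝ)).sub ((contDiffAt_const (c := (2 : ℝ)).mul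
    hZ).div (hn.mul (hn.add (hc (0, 0)))) (mul_pos hn0 (add_pos hn0 hp)).ne')).div_const 300
  have hsT : ContDiff ℝ ∞ Real.smoothTransition := Real.smoothTransition.contDiff
  exact (((contDiffAt_const.mul (hsT.contDiffAt.comp p harg)).mul ((hc (1, 0)).pow 2)).mul
    (hc (1, 1))).div (hc (0, 0)) hp.ne'

/-- In the blown-up variables the support of the cutoff stays bounded. As `s → 0` the argument of the
cutoff tends to the sum of the squares of the three entries, up to the factor `2 / (1 + 1) = 1`, so
the support tends to the ball of radius `20`; the bound `800` leaves room for small `s`. -/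
theorem eventually_blowUp_eq_zero {s : ℝ} (hs : 0 ≤ s) (hs1 : s ≤ 1 / 100) {w : Mat}
    (hw : w (0, 0) = 1) (hZ : 800 < w (0, 1) ^ 2 + w (1, 0) ^ 2 + w (1, 1) ^ 2) :
    blowUp =ᶠ[𝓝 (s, w)] fun _ => 0 := by
  let n : ℝ × Mat → ℝ := fun p =>
    √(p.2 (0, 0) ^ 2 + p.1 ^ 2 * (p.2 (0, 1) ^ 2 + p.2 (1, 0) ^ 2 + p.2 (1, 1) ^ 2))
  have hn : Continuous n := by fun_prop
  have ho : IsOpen {p : ℝ × Mat | 400 * (n p * (n p + p.2 (0, 0)))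
      < 2 * (p.2 (0, 1) ^ 2 + p.2 (1, 0) ^ 2 + p.2 (1, 1) ^ 2)} :=
    isOpen_lt (by fun_prop) (by fun_prop)
  have ho' : IsOpen {p : ℝ × Mat | 0 < p.2 (0, 0)} := isOpen_lt (by fun_prop) (by fun_prop)
  have hmem : 400 * (n (s, w) * (n (s, w) + w (0, 0)))
      < 2 * (w (0, 1) ^ 2 + w (1, 0) ^ 2 + w (1, 1) ^ 2) := by
    have h1 : n (s, w) ^ 2
        = 1 + s ^ 2 * (w (0, 1) ^ 2 + w (1, 0) ^ 2 + w (1, 1) ^ 2) := by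
      simp only [n]
      rw [Real.sq_sqrt (by positivity), hw]
      ring
    have h2 : s ^ 2 ≤ 1 / 10000 := by nlinarith
    have h3 := mul_le_mul_of_nonneg_right h2
      (show 0 ≤ w (0, 1) ^ 2 + w (1, 0) ^ 2 + w (1, 1) ^ 2 by positivity)
    rw [hw]
    nlinarith [sq_nonneg (n (s, w) - 1)]
  filter_upwards [ho.mem_nhds hmem, ho'.mem_nhds (show 0 < w (0, 0) by rw [hw]; exact one_pos)]
    with p hp hp0
  have hp0' : 0 < p.2 (0, 0) := hp0
  have hn0 : 0 < n p := Real.sqrt_pos.2 (by positivity)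
  have hp' : 400 * (n p * (n p + p.2 (0, 0)))
      < 2 * (p.2 (0, 1) ^ 2 + p.2 (1, 0) ^ 2 + p.2 (1, 1) ^ 2) := hp
  have h1 : 400 ≤ 2 * (p.2 (0, 1) ^ 2 + p.2 (1, 0) ^ 2 + p.2 (1, 1) ^ 2) /
      (n p * (n p + p.2 (0, 0))) := by
    rw [le_div_iff₀ (by positivity)]
    exact hp'.le
  rw [blowUp, Real.smoothTransition.zero_of_nonpos]
  · ring
  · simp only [n] at h1
    linarith

theorem continuousAt_norm_of_contDiffAt {E F : Type*} [NormedAddCommGroup E] [NormedSpace ℝ E]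
    [NormedAddCommGroup F] [NormedSpace ℝ F] {u : E → F} {x : E} (hu : ContDiffAt ℝ ∞ u x) :
    ContinuousAt (fun x => ‖u x‖) x :=
  hu.continuousAt.norm

theorem exists_bound_blowUp : ∃ M : ℝ, 0 < M ∧ ∀ s ∈ Icc (0 : ℝ) (1 / 100), ∀ w : Mat,
    w (0, 0) = 1 → ‖fderiv ℝ (fderiv ℝ blowUp) (s, w)‖ ≤ M := by
  have hK : IsCompact (Icc (0 : ℝ) (1 / 100) ×ˢ
      (Metric.closedBall (0 : Mat) 30 ∩ {w : Mat | w (0, 0) = 1})) :=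
    isCompact_Icc.prod ((isCompact_closedBall _ _).inter_right
      (isClosed_eq (by fun_prop) continuous_const))
  have hcont : ContinuousOn (fun p => ‖fderiv ℝ (fderiv ℝ blowUp) p‖) (Icc (0 : ℝ) (1 / 100) ×ˢ
      (Metric.closedBall (0 : Mat) 30 ∩ {w : Mat | w (0, 0) = 1})) := by
    intro p hp
    have h0 : 0 < p.2 (0, 0) := by rw [show p.2 (0, 0) = 1 from hp.2.2]; exact one_pos
    have h1 : ContDiffAt ℝ ∞ (fderiv ℝ (fderiv ℝ blowUp)) p :=
      ((contDiffAt_blowUp h0).fderiv_right (m := ∞) (by simp)).fderiv_right (by simp)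
    exact (continuousAt_norm_of_contDiffAt h1).continuousWithinAt
  obtain ⟨M, hM⟩ := hK.bddAbove_image hcont
  refine ⟨max M 1, by positivity, fun s hs w hw => ?_⟩
  rcases le_or_gt (w (0, 1) ^ 2 + w (1, 0) ^ 2 + w (1, 1) ^ 2) 800 with hZ | hZ
  · refine le_max_of_le_left (hM ⟨(s, w), ⟨hs, ?_, hw⟩, rfl⟩)
    rw [mem_closedBall_zero_iff]
    have := norm_sq_eq_sum w
    rw [hw] at this
    nlinarith [norm_nonneg w]
  · have h1 := ((eventually_blowUp_eq_zero hs.1 hs.2 hw hZ).fderiv (𝕜 := ℝ)).fderiv_eq (𝕜 := ℝ)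
    have h2 : fderiv ℝ (fderiv ℝ fun _ : ℝ × Mat => (0 : ℝ)) (s, w) = 0 := by simp
    exact (norm_eq_zero.2 (h1.trans h2)).trans_le (le_max_of_le_right zero_le_one)

theorem fderiv_real_smul {E F : Type*} [NormedAddCommGroup E] [NormedSpace ℝ E]
    [NormedAddCommGroup F] [NormedSpace ℝ F] (t : ℝ) (u : E → F) (x : E) :
    fderiv ℝ (t • u) x = t • fderiv ℝ u x :=
  congrFun (fderiv_const_smul_field t) x

theorem norm_fderiv_real_smul {E F : Type*} [NormedAddCommGroup E] [NormedSpace ℝ E]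
    [NormedAddCommGroup F] [NormedSpace ℝ F] {t : ℝ} (ht : 0 ≤ t) (u : E → F) (x : E) :
    ‖fderiv ℝ (t • u) x‖ = t * ‖fderiv ℝ u x‖ := by
  rw [fderiv_real_smul, norm_smul, Real.norm_of_nonneg ht]

theorem norm_fderiv_fderiv_comp_le {E G : Type*} [NormedAddCommGroup E] [NormedSpace ℝ E]
    [NormedAddCommGroup G] [NormedSpace ℝ G] {u : G → ℝ} {φ : E → G} {L : E →L[ℝ] G}
    (hφ : ∀ y, HasFDerivAt φ L y) {y : E} (hu : ContDiffAt ℝ ∞ u (φ y)) :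
    ‖fderiv ℝ (fderiv ℝ (u ∘ φ)) y‖ ≤ ‖fderiv ℝ (fderiv ℝ u) (φ y)‖ * ‖L‖ ^ 2 := by
  have h1 : fderiv ℝ (u ∘ φ) =ᶠ[𝓝 y] fun z => (fderiv ℝ u (φ z)).comp L := by
    have h2 : ∀ᶠ z in 𝓝 y, ContDiffAt ℝ 1 u (φ z) :=
      (hφ y).continuousAt.eventually ((hu.of_le (by exact_mod_cast le_top)).eventually (by simp))
    filter_upwards [h2] with z hz
    exact ((hz.differentiableAt (by simp)).hasFDerivAt.comp z (hφ z)).fderiv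
  have h3 : HasFDerivAt (fderiv ℝ u) (fderiv ℝ (fderiv ℝ u) (φ y)) (φ y) :=
    ((hu.fderiv_right (m := ∞) (by simp)).differentiableAt (by simp)).hasFDerivAt
  have h4 := ((ContinuousLinearMap.compL ℝ E G ℝ).flip L).hasFDerivAt.comp y (h3.comp y (hφ y))
  have h5 : fderiv ℝ (fderiv ℝ (u ∘ φ)) y = _ := h1.fderiv_eq.trans h4.fderiv
  rw [h5]
  refine ContinuousLinearMap.opNorm_le_bound _ (by positivity) fun z => ?_
  change ‖(fderiv ℝ (fderiv ℝ u) (φ y) (L z)).comp L‖ ≤ _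
  refine (ContinuousLinearMap.opNorm_comp_le _ _).trans ?_
  have h6 : ‖fderiv ℝ (fderiv ℝ u) (φ y) (L z)‖
      ≤ ‖fderiv ℝ (fderiv ℝ u) (φ y)‖ * (‖L‖ * ‖z‖) :=
    (ContinuousLinearMap.le_opNorm _ _).trans (by gcongr; exact L.le_opNorm z)
  calc ‖fderiv ℝ (fderiv ℝ u) (φ y) (L z)‖ * ‖L‖
      ≤ ‖fderiv ℝ (fderiv ℝ u) (φ y)‖ * (‖L‖ * ‖z‖) * ‖L‖ := by gcongr
    _ = _ := by ring

/-- The rescaling that multiplies all entries but the first one by `s⁻¹`. -/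
noncomputable def rescale (s : ℝ) : Mat →L[ℝ] Mat :=
  s⁻¹ • ContinuousLinearMap.id ℝ Mat + (1 - s⁻¹) •
    (EuclideanSpace.proj (0, 0) : Mat →L[ℝ] ℝ).smulRight (tensor (basisVec 0) (basisVec 0))

theorem rescale_apply (s : ℝ) (x : Mat) :
    rescale s x (0, 0) = x (0, 0) ∧ rescale s x (0, 1) = s⁻¹ * x (0, 1) ∧
      rescale s x (1, 0) = s⁻¹ * x (1, 0) ∧ rescale s x (1, 1) = s⁻¹ * x (1, 1) := by
  refine ⟨?_, ?_, ?_, ?_⟩ <;> simp [rescale, tensor_apply, basisVec]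
  ring

theorem norm_rescale_le {s : ℝ} (hs : 0 < s) (hs1 : s ≤ 1) : ‖rescale s‖ ≤ s⁻¹ := by
  refine ContinuousLinearMap.opNorm_le_bound _ (by positivity) fun x => ?_
  obtain ⟨h1, h2, h3, h4⟩ := rescale_apply s x
  have h5 := norm_sq_eq_sum (rescale s x)
  rw [h1, h2, h3, h4] at h5
  have h6 := norm_sq_eq_sum x
  have h7 : 1 ≤ s⁻¹ := (one_le_inv₀ hs).2 hs1
  refine abs_le_of_sq_le_sq' ?_ (by positivity) |>.2
  rw [h5, mul_pow s⁻¹ ‖x‖, h6]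
  have h8 : 1 ≤ s⁻¹ ^ 2 := one_le_pow₀ h7
  nlinarith [mul_le_mul_of_nonneg_right h8 (sq_nonneg (x (0, 0)))]

theorem perturbation_eq_blowUp {ε : ℝ} (hε : 0 < ε) (hε1 : ε ≤ 1 / 100) {x : Mat}
    (hx : 0 < x (0, 0)) : perturbation (cutoff ε) x = ε ^ 3 * blowUp (ε, rescale ε x) := by
  have hx0 : x ≠ 0 := by rintro rfl; simp at hx
  have hn : 0 < ‖x‖ := norm_pos_iff.2 hx0
  obtain ⟨h1, h2, h3, h4⟩ := rescale_apply ε x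
  have h5 := norm_sq_eq_sum x
  have hcut : cutoff ε (‖x‖⁻¹ • x)
      = Real.smoothTransition ((400 - (2 - 2 * (x (0, 0) / ‖x‖)) / ε ^ 2) / 300) := by
    have h6 : 0 < x (0, 0) / ‖x‖ := by positivity
    rw [cutoff, bump_eq_zero hε (x := -(‖x‖⁻¹ • x)), bump, norm_sq_inv_norm_smul_sub hx0]
    · ring
    · rw [norm_sq_neg_inv_norm_smul_sub hx0]
      nlinarith
  have hsq : √(x (0, 0) ^ 2
      + ε ^ 2 * ((ε⁻¹ * x (0, 1)) ^ 2 + (ε⁻¹ * x (1, 0)) ^ 2 + (ε⁻¹ * x (1, 1)) ^ 2)) = ‖x‖ := by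
    rw [← Real.sqrt_sq hn.le, h5]
    congr 1
    field_simp
    ring
  have harg : 2 * ((ε⁻¹ * x (0, 1)) ^ 2 + (ε⁻¹ * x (1, 0)) ^ 2 + (ε⁻¹ * x (1, 1)) ^ 2)
      / (‖x‖ * (‖x‖ + x (0, 0))) = (2 - 2 * (x (0, 0) / ‖x‖)) / ε ^ 2 := by
    have h6 : 0 < ‖x‖ + x (0, 0) := by positivity
    field_simp
    linarith
  rw [perturbation, hcut, blowUp]
  simp only [h1, h2, h3, h4, hsq, harg, PiLp.smul_apply, smul_eq_mul]
  field_simp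

theorem fderiv_fderiv_smul_of_homogeneous {q : Mat → ℝ}
    (hq : ∀ (t : ℝ) (x : Mat), q (t • x) = t ^ 2 * q x) {t : ℝ} (ht : t ≠ 0) (x : Mat) :
    fderiv ℝ (fderiv ℝ q) (t • x) = fderiv ℝ (fderiv ℝ q) x := by
  have h1 : (fun x => t • fderiv ℝ q (t • x)) = t ^ 2 • fderiv ℝ q := by
    ext1 y
    have h2 : fderiv ℝ (fun x => q (t • x)) y = t • fderiv ℝ q (t • y) := fderiv_comp_smul t
    have h3 : (fun x => q (t • x)) = t ^ 2 • q := by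
      ext z; simp [hq]
    rw [← h2, h3, fderiv_const_smul_field]
  have h4 : fderiv ℝ (fun x => fderiv ℝ q (t • x)) x = t • fderiv ℝ (fderiv ℝ q) (t • x) :=
    fderiv_comp_smul t
  have h5 := fderiv_real_smul t (fun x => fderiv ℝ q (t • x)) x
  have h6 : (t • fun x => fderiv ℝ q (t • x)) = t ^ 2 • fderiv ℝ q := h1
  have h7 := fderiv_real_smul (t ^ 2) (fderiv ℝ q) x
  rw [h6, h7, h4, smul_smul, ← pow_two] at h5
  exact (smul_right_injective _ (pow_ne_zero 2 ht) h5).symm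

/-- The perturbation vanishes to third order at `e₁ ⊗ e₁` in the directions of the blow-up, so its
second derivative is of the order of the cutoff parameter. -/
theorem exists_norm_fderiv_fderiv_perturbation_le {c : ℝ} (hc : 0 < c) :
    ∃ ε : ℝ, 0 < ε ∧ ε ≤ 1 / 100 ∧
      ∀ x, x ≠ 0 → ‖fderiv ℝ (fderiv ℝ (perturbation (cutoff ε))) x‖ ≤ c := by
  obtain ⟨M, hM0, hM⟩ := exists_bound_blowUp
  have hε : 0 < min (1 / 100) (c / M) := lt_min (by norm_num) (by positivity)
  refine ⟨min (1 / 100) (c / M), hε, min_le_left _ _, fun x hx => ?_⟩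
  have hε1 : min (1 / 100) (c / M) ≤ 1 / 100 := min_le_left _ _
  have hεc : min (1 / 100) (c / M) * M ≤ c := by
    rw [← le_div_iff₀ hM0]
    exact min_le_right _ _
  generalize min (1 / 100) (c / M) = ε at hε hε1 hεc
  by_cases hx0 : x (0, 0) = 0
  · rw [((eventually_perturbation_eq_zero hε hε1 hx hx0).fderiv (𝕜 := ℝ)).fderiv_eq]
    have h2 : fderiv ℝ (fderiv ℝ fun _ : Mat => (0 : ℝ)) x = 0 := by simp
    exact ((norm_eq_zero (E := Mat →L[ℝ] Mat →L[ℝ] ℝ)).2 h2).trans_le hc.le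
  · -- normalise the first entry of `x` to `1`
    rw [← fderiv_fderiv_smul_of_homogeneous (perturbation_smul (cutoff_neg ε)) (inv_ne_zero hx0) x]
    set y := (x (0, 0))⁻¹ • x with hy
    have hy1 : y (0, 0) = 1 := by simp [hy, hx0]
    have h1 : perturbation (cutoff ε)
        =ᶠ[𝓝 y] ε ^ 3 • (blowUp ∘ fun x => (ε, rescale ε x)) := by
      have ho : IsOpen {z : Mat | 0 < z (0, 0)} := isOpen_lt (by fun_prop) (by fun_prop)
      filter_upwards [ho.mem_nhds (show 0 < y (0, 0) by rw [hy1]; exact one_pos)] with z hz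
      exact perturbation_eq_blowUp hε hε1 hz
    have h2 : ∀ z, HasFDerivAt (fun x => (ε, rescale ε x))
        ((0 : Mat →L[ℝ] ℝ).prod (rescale ε)) z := fun z =>
      (hasFDerivAt_const ε z).prodMk (rescale ε).hasFDerivAt
    have h3 : rescale ε y (0, 0) = 1 := by rw [(rescale_apply ε y).1, hy1]
    have h4 := norm_fderiv_fderiv_comp_le h2 (y := y) (u := blowUp)
      (contDiffAt_blowUp (by rw [h3]; exact one_pos))
    have h5 : ‖(0 : Mat →L[ℝ] ℝ).prod (rescale ε)‖ ≤ ε⁻¹ := by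
      refine ContinuousLinearMap.opNorm_le_bound _ (by positivity) fun z => ?_
      rw [ContinuousLinearMap.prod_apply, Prod.norm_def, zero_apply, norm_zero,
        max_eq_right (norm_nonneg _)]
      exact ContinuousLinearMap.le_of_opNorm_le _ (norm_rescale_le hε (by linarith)) z
    rw [h1.fderiv.fderiv_eq, fderiv_const_smul_field]
    refine (norm_fderiv_real_smul (pow_nonneg hε.le 3) _ y).trans_le ?_
    calc ε ^ 3 * ‖fderiv ℝ (fderiv ℝ (blowUp ∘ fun x => (ε, rescale ε x))) y‖
        ≤ ε ^ 3 * (M * ε⁻¹ ^ 2) := by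
          refine mul_le_mul_of_nonneg_left (h4.trans ?_) (by positivity)
          gcongr
          exact hM ε ⟨hε.le, hε1⟩ _ h3
      _ = ε * M := by field_simp
      _ ≤ c := hεc

theorem exists_isSmallPerturbation :
    ∃ ε : ℝ, 0 < ε ∧ ε ≤ 1 / 100 ∧
      IsSmallPerturbation quadOperator (perturbation (cutoff ε)) (1 / 4) := by
  obtain ⟨ε, hε, hε1, h⟩ := exists_norm_fderiv_fderiv_perturbation_le (c := 1 / 4) (by norm_num)
  refine ⟨ε, hε, hε1, by norm_num, fun x y => ?_, fun x => ?_, perturbation_smul (cutoff_neg ε),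
    contDiffOn_perturbation hε hε1, h⟩
  · rw [quadOperator_apply, quadOperator_apply, real_inner_comm (quadMap y) x, inner_quadMap,
      inner_quadMap]
    ring
  · -- the smallest eigenvalue of `A` is `(3 - √5) / 2 > 1 / 4`
    rw [quadOperator_apply, inner_quadMap, norm_sq_eq_sum]
    nlinarith [sq_nonneg (3 * x (1, 0) + 4 * x (0, 1)), sq_nonneg (x (0, 1)), sq_nonneg (x (0, 0)),
      sq_nonneg (x (1, 1))]

/-! ### The gradient at `v ⊗ v` and the failure of quasi-isotropy -/

theorem perturbedForm_of_apply_eq_zero (η : Mat → ℝ) {x : Mat} (hx : x (1, 1) = 0) :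
    perturbedForm quadOperator (perturbation η) x
      = x (0, 0) ^ 2 + 2 * x (0, 1) ^ 2 + 2 * x (0, 1) * x (1, 0) + x (1, 0) ^ 2 := by
  have h1 : perturbation η x = 0 := by simp [perturbation, hx]
  rw [perturbedForm, h1, quadOperator_apply, inner_quadMap, hx]
  ring

/-- The explicit form of the perturbation in the cone where the cutoff is `1`. -/
theorem perturbation_eq_of_near {ε : ℝ} (hε : 0 < ε) {x : Mat} (hx : 0 < x (0, 0))
    (hx' : (1 - 50 * ε ^ 2) * ‖x‖ < x (0, 0)) :
    perturbation (cutoff ε) x = 2 * x (1, 0) ^ 2 / x (0, 0) * x (1, 1) := by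
  have hx0 : x ≠ 0 := by rintro rfl; simp at hx
  have hn : 0 < ‖x‖ := norm_pos_iff.2 hx0
  have h1 : ‖‖x‖⁻¹ • x - tensor (basisVec 0) (basisVec 0)‖ ≤ 10 * ε := by
    refine abs_le_of_sq_le_sq' ?_ (by positivity) |>.2
    rw [norm_sq_inv_norm_smul_sub hx0]
    rw [← lt_div_iff₀ hn] at hx'
    linarith
  rw [perturbation, (isCutoff_cutoff hε).eq_one _ h1]
  simp only [PiLp.smul_apply, smul_eq_mul]
  field_simp

theorem fderiv_perturbation_of_near {ε : ℝ} (hε : 0 < ε) {x : Mat} (hx : 0 < x (0, 0))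
    (hx' : (1 - 50 * ε ^ 2) * ‖x‖ < x (0, 0)) (hx1 : x (1, 1) = 0) (y : Mat) :
    fderiv ℝ (perturbation (cutoff ε)) x y = 2 * x (1, 0) ^ 2 / x (0, 0) * y (1, 1) := by
  have h1 : perturbation (cutoff ε)
      =ᶠ[𝓝 x] fun x => 2 * x (1, 0) ^ 2 / x (0, 0) * x (1, 1) := by
    have ho : IsOpen {z : Mat | 0 < z (0, 0)} := isOpen_lt (by fun_prop) (by fun_prop)
    have ho' : IsOpen {z : Mat | (1 - 50 * ε ^ 2) * ‖z‖ < z (0, 0)} :=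
      isOpen_lt (by fun_prop) (by fun_prop)
    filter_upwards [ho.mem_nhds hx, ho'.mem_nhds hx'] with z hz hz'
    exact perturbation_eq_of_near hε hz hz'
  have hc : ∀ i, HasFDerivAt (fun z : Mat => z i) (EuclideanSpace.proj i : Mat →L[ℝ] ℝ) x :=
    fun i => (EuclideanSpace.proj i : Mat →L[ℝ] ℝ).hasFDerivAt
  have hd : ∀ i, DifferentiableAt ℝ (fun z : Mat => z i) x := fun i => (hc i).differentiableAt
  have h2 : DifferentiableAt ℝ (fun z : Mat => 2 * z (1, 0) ^ 2 / z (0, 0)) x := by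
    simp only [div_eq_mul_inv]
    exact (((hd (1, 0)).fun_pow 2).const_mul 2).fun_mul ((hd (0, 0)).fun_inv hx.ne')
  have h3 := h2.hasFDerivAt.fun_mul (hc (1, 1))
  rw [h1.fderiv_eq, h3.fderiv]
  simp [hx1]

theorem planeVec_apply {a b : ℝ} {v : Plane} (hv : v = a • basisVec 0 + b • basisVec 1) :
    v 0 = a ∧ v 1 = b := by
  subst hv
  constructor <;> simp [basisVec]

/-- The vector `v ⊗ v` is the half gradient of `⟨A y, y⟩ + q y` at `y = a v ⊗ e₁`: the operator `A`
contributes all the entries except `b²` at `e₂ ⊗ e₂`, which comes from `q`. -/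
theorem halfGradient_smul_tensor {ε : ℝ} (hε : 0 < ε) {a b : ℝ} {v : Plane}
    (hab : |b| < ε * |a|) (hv : v = a • basisVec 0 + b • basisVec 1) :
    halfGradient quadOperator (perturbation (cutoff ε)) (a • tensor v (basisVec 0))
      = tensor v v := by
  obtain ⟨hv0, hv1⟩ := planeVec_apply hv
  have ha : a ≠ 0 := by
    rintro rfl
    rw [abs_zero, mul_zero] at hab
    exact absurd hab (abs_nonneg b).not_gt
  set y : Mat := a • tensor v (basisVec 0) with hy
  have hy00 : y (0, 0) = a ^ 2 := by simp [hy, tensor_apply, basisVec, hv0, pow_two]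
  have hy01 : y (0, 1) = 0 := by simp [hy, tensor_apply, basisVec]
  have hy10 : y (1, 0) = a * b := by simp [hy, tensor_apply, basisVec, hv1]
  have hy11 : y (1, 1) = 0 := by simp [hy, tensor_apply, basisVec]
  have ha2 : 0 < a ^ 2 := by positivity
  have hb2 : b ^ 2 ≤ ε ^ 2 * a ^ 2 := by
    rw [← sq_abs b, ← sq_abs a, ← mul_pow]
    exact pow_le_pow_left₀ (abs_nonneg b) hab.le 2
  have hnear : (1 - 50 * ε ^ 2) * ‖y‖ < y (0, 0) := by
    have h1 : ‖y‖ ≤ a ^ 2 * (1 + ε ^ 2) := by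
      refine abs_le_of_sq_le_sq' ?_ (by positivity) |>.2
      rw [norm_sq_eq_sum, hy00, hy01, hy10, hy11]
      nlinarith [mul_le_mul_of_nonneg_left hb2 ha2.le, sq_nonneg (a ^ 2 * ε ^ 2),
        sq_nonneg (a ^ 2 * ε)]
    rw [hy00]
    rcases le_or_gt (1 - 50 * ε ^ 2) 0 with h2 | h2
    · exact lt_of_le_of_lt (mul_nonpos_of_nonpos_of_nonneg h2 (norm_nonneg y)) ha2
    · have h3 := mul_le_mul_of_nonneg_left h1 h2.le
      have h4 : 0 < a ^ 2 * ε ^ 2 := by positivity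
      nlinarith [sq_nonneg (a * ε ^ 2)]
  have hgrad : ∀ z : Mat, ⟪gradient (perturbation (cutoff ε)) y, z⟫ = 2 * b ^ 2 * z (1, 1) :=
    fun z => by
      rw [IsSmallPerturbation.inner_gradient, fderiv_perturbation_of_near hε (hy00 ▸ ha2) hnear
        hy11, hy00, hy10]
      field_simp
  refine ext_inner_right ℝ fun z => ?_
  rw [halfGradient, inner_add_left, real_inner_smul_left, hgrad, quadOperator_apply,
    inner_quadMap, inner_eq_sum, hy00, hy01, hy10, hy11]
  simp only [tensor_apply, hv0, hv1]
  ring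

theorem gradientInverse_tensor {ε c : ℝ} (hε : 0 < ε)
    (h : IsSmallPerturbation quadOperator (perturbation (cutoff ε)) c) {a b : ℝ} {v : Plane}
    (hab : |b| < ε * |a|) (hv : v = a • basisVec 0 + b • basisVec 1) :
    h.gradientInverse (tensor v v) = a • tensor v (basisVec 0) := by
  rw [← halfGradient_smul_tensor hε hab hv, h.gradientInverse_halfGradient]

theorem dualNorm_tensor_sq {ε c : ℝ} (hε : 0 < ε)
    (h : IsSmallPerturbation quadOperator (perturbation (cutoff ε)) c) {a b : ℝ} {v : Plane}
    (hab : |b| < ε * |a|) (hv : v = a • basisVec 0 + b • basisVec 1) :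
    dualNorm (perturbedQuadratic (cutoff ε)) (tensor v v) ^ 2 = a ^ 2 * (a ^ 2 + b ^ 2) := by
  obtain ⟨hv0, hv1⟩ := planeVec_apply hv
  rw [perturbedQuadratic_eq, h.dualNorm_sq, gradientInverse_tensor hε h hab hv,
    real_inner_smul_right, inner_eq_sum]
  simp [tensor_apply, basisVec, hv0, hv1]
  ring

theorem hasGradientAt_dualNorm_tensor {ε c : ℝ} (hε : 0 < ε)
    (h : IsSmallPerturbation quadOperator (perturbation (cutoff ε)) c) {a b : ℝ} {v : Plane}
    (hab : |b| < ε * |a|) (hv : v = a • basisVec 0 + b • basisVec 1) :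
    HasGradientAt (dualNorm (perturbedQuadratic (cutoff ε)))
      ((a / dualNorm (perturbedQuadratic (cutoff ε)) (tensor v v)) • tensor v (basisVec 0))
      (tensor v v) := by
  obtain ⟨hv0, hv1⟩ := planeVec_apply hv
  have hne : tensor v v ≠ 0 := fun h0 => by
    have h1 : tensor v v (0, 0) = 0 := by rw [h0]; rfl
    rw [tensor_apply, hv0, mul_self_eq_zero] at h1
    rw [h1, abs_zero, mul_zero] at hab
    exact absurd hab (abs_nonneg b).not_gt
  have h1 := h.hasGradientAt_dualNorm hne
  rw [gradientInverse_tensor hε h hab hv, smul_smul] at h1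
  rw [perturbedQuadratic_eq, div_eq_inv_mul]
  exact h1

theorem one_le_dualNorm_tensor {η : Mat → ℝ} {c : ℝ}
    (h : IsSmallPerturbation quadOperator (perturbation η) c) {v : Plane} (hv0 : v 0 = 1) :
    1 ≤ dualNorm (perturbedQuadratic η) (tensor (basisVec 0) v) := by
  have h1 := h.inner_le_dualNorm (tensor (basisVec 0) v) (tensor (basisVec 0) (basisVec 0))
  rw [perturbedForm_of_apply_eq_zero _ (by simp [tensor_apply, basisVec]), inner_eq_sum] at h1
  simp only [tensor_apply, hv0, basisVec, PiLp.single_apply] at h1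
  norm_num at h1
  exact h1

theorem le_dualNorm_tensor_sq {η : Mat → ℝ} {c : ℝ}
    (h : IsSmallPerturbation quadOperator (perturbation η) c) {v : Plane} {b : ℝ}
    (hv0 : v 0 = 1) (hv1 : v 1 = b) :
    (1 + b ^ 2) ^ 2
      ≤ dualNorm (perturbedQuadratic η) (tensor v (basisVec 0)) ^ 2 * (1 + b ^ 2 / 2) := by
  -- subtracting `(b / 2) e₁ ⊗ e₂` keeps the pairing with `v ⊗ e₁` and decreases the norm
  have h1 := h.inner_le_dualNorm (tensor v (basisVec 0))
    (tensor v (basisVec 0) - (b / 2) • tensor (basisVec 0) (basisVec 1))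
  rw [perturbedForm_of_apply_eq_zero _ (by simp [tensor_apply, basisVec]), inner_eq_sum] at h1
  simp only [tensor_apply, PiLp.sub_apply, PiLp.smul_apply, smul_eq_mul, hv0, hv1, basisVec,
    PiLp.single_apply] at h1
  norm_num at h1
  have h3 : 1 + b ^ 2 ≤ dualNorm (perturbedQuadratic η) (tensor v (basisVec 0))
      * √(1 + b ^ 2 / 2) := by
    refine le_of_eq_of_le (by ring) (h1.trans_eq ?_)
    rw [← perturbedQuadratic_eq]
    congr 2
    ring
  have h4 := pow_le_pow_left₀ (by positivity) h3 2
  rwa [mul_pow, Real.sq_sqrt (by positivity)] at h4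

theorem inner_eq_of_hasGradientAt {f : Mat → ℝ} (hN : IsNorm f) {g x : Mat}
    (hg : HasGradientAt f g x) : ⟪g, x⟫ = f x := by
  have := fderiv_apply_self_of_homogeneous (k := 1) hg.hasFDerivAt
    (fun t ht => by rw [hN.smul, abs_of_pos ht, pow_one, smul_eq_mul])
  simpa using this

/-- If the gradient of `f` splits on rank-one matrices and is parallel to `v ⊗ e₁` at `v ⊗ v` and at
`e₁ ⊗ e₁`, then Euler's relation determines the product of `f (v ⊗ e₁)` and `f (e₁ ⊗ v)`. -/
theorem mul_mul_eq_of_splitting {f : Mat → ℝ} (hN : IsNorm f) {μ₁ μ₂ : Plane → Plane}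
    (hμ : ∀ v₁ v₂ : Plane, v₁ ≠ 0 → v₂ ≠ 0 →
      HasGradientAt f (tensor (μ₁ v₁) (μ₂ v₂)) (tensor v₁ v₂))
    {v e : Plane} {b φ : ℝ} (hφ : φ ≠ 0) (hv0 : v 0 = 1) (hv1 : v 1 = b) (he0 : e 0 = 1)
    (he1 : e 1 = 0) (hv : HasGradientAt f (φ⁻¹ • tensor v e) (tensor v v))
    (he : HasGradientAt f (tensor e e) (tensor e e)) :
    f (tensor v e) * f (tensor e v) * φ = 1 + b ^ 2 := by
  have hvne : v ≠ 0 := fun h0 => by simp [h0] at hv0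
  have hene : e ≠ 0 := fun h0 => by simp [h0] at he0
  have gv := (hμ v v hvne hvne).unique hv
  have ge := (hμ e e hene hene).unique he
  have gv00 : μ₁ v 0 * μ₂ v 0 = φ⁻¹ := by
    have := congrArg (fun x : Mat => x (0, 0)) gv
    simpa only [tensor_apply, PiLp.smul_apply, hv0, he0, mul_one, smul_eq_mul] using this
  have gv01 : μ₁ v 0 * μ₂ v 1 = 0 := by
    have := congrArg (fun x : Mat => x (0, 1)) gv
    simpa only [tensor_apply, PiLp.smul_apply, he1, mul_zero, smul_zero] using this
  have gv10 : μ₁ v 1 * μ₂ v 0 = φ⁻¹ * b := by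
    have := congrArg (fun x : Mat => x (1, 0)) gv
    simpa only [tensor_apply, PiLp.smul_apply, hv1, he0, mul_one, smul_eq_mul] using this
  have ge00 : μ₁ e 0 * μ₂ e 0 = 1 := by
    have := congrArg (fun x : Mat => x (0, 0)) ge
    simpa only [tensor_apply, he0, mul_one] using this
  have hr1 : μ₂ v 1 = 0 := by
    rcases mul_eq_zero.1 gv01 with h0 | h0
    · rw [h0, zero_mul] at gv00
      exact absurd gv00.symm (inv_ne_zero hφ)
    · exact h0
  have e1 := inner_eq_of_hasGradientAt hN (hμ v e hvne hene)
  have e2 := inner_eq_of_hasGradientAt hN (hμ e v hene hvne)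
  rw [inner_eq_sum] at e1 e2
  simp only [tensor_apply, hv0, hv1, he0, he1, hr1] at e1 e2
  rw [← e1, ← e2]
  calc _ = (μ₁ v 0 * μ₂ v 0 + b * (μ₁ v 1 * μ₂ v 0)) * (μ₁ e 0 * μ₂ e 0) * φ := by ring
    _ = _ := by
      rw [gv00, gv10, ge00]
      field_simp

/-- The explicit form of the gradient at `v ⊗ v` and at `e₁ ⊗ e₁` would determine the product of the
norms of `v ⊗ e₁` and `e₁ ⊗ v` if the gradient split; testing the definition of the dual norm shows
that this product is larger. -/
theorem not_quasiIsotropic {ε c : ℝ} (hε : 0 < ε)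
    (h : IsSmallPerturbation quadOperator (perturbation (cutoff ε)) c) :
    ¬ QuasiIsotropic (dualNorm (perturbedQuadratic (cutoff ε))) := by
  rintro ⟨μ₁, μ₂, -, -, hμ⟩
  have hN : IsNorm (dualNorm (perturbedQuadratic (cutoff ε))) := h.isNorm_dualNorm
  rw [recession_eq_self fun t ξ ht => by rw [hN.smul, abs_of_pos ht]] at hμ
  obtain ⟨b, hb0, hbε⟩ : ∃ b : ℝ, 0 < b ∧ b < ε := ⟨ε / 2, by positivity, by linarith⟩
  obtain ⟨v, hv⟩ : ∃ v : Plane, v = (1 : ℝ) • basisVec 0 + b • basisVec 1 := ⟨_, rfl⟩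
  have hbv : |b| < ε * |(1 : ℝ)| := by rwa [abs_of_pos hb0, abs_one, mul_one]
  have hbe : |(0 : ℝ)| < ε * |(1 : ℝ)| := by simpa using hε
  have he : basisVec 0 = (1 : ℝ) • basisVec 0 + (0 : ℝ) • basisVec 1 := by simp
  obtain ⟨hv0, hv1⟩ := planeVec_apply hv
  obtain ⟨he0, he1⟩ := planeVec_apply he
  have hfv := dualNorm_tensor_sq hε h hbv hv
  have hfe := dualNorm_tensor_sq hε h hbe he
  have gv := hasGradientAt_dualNorm_tensor hε h hbv hv
  have ge := hasGradientAt_dualNorm_tensor hε h hbe he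
  have l1 := one_le_dualNorm_tensor h hv0
  have l2 := le_dualNorm_tensor_sq h hv0 hv1
  have hnn : ∀ x, 0 ≤ dualNorm (perturbedQuadratic (cutoff ε)) x := h.dualNorm_nonneg
  generalize dualNorm (perturbedQuadratic (cutoff ε)) = f at *
  have hfe1 : f (tensor (basisVec 0) (basisVec 0)) = 1 := by
    nlinarith [hnn (tensor (basisVec 0) (basisVec 0))]
  rw [hfe1, div_one, one_smul] at ge
  rw [one_div] at gv
  have hφ0 : 0 < f (tensor v v) :=
    lt_of_le_of_ne (hnn _) fun h0 => by rw [← h0] at hfv; nlinarith [sq_nonneg b]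
  have hprod := mul_mul_eq_of_splitting hN hμ hφ0.ne' hv0 hv1 he0 he1 gv ge
  have hF := hnn (tensor v (basisVec 0))
  generalize f (tensor v v) = φ at *
  generalize f (tensor v (basisVec 0)) = F at *
  generalize f (tensor (basisVec 0) v) = F' at *
  have h5 : F * φ ≤ 1 + b ^ 2 := by
    rw [← hprod]
    nlinarith [mul_nonneg hF hφ0.le]
  have h6 := pow_le_pow_left₀ (mul_nonneg hF hφ0.le) h5 2
  rw [mul_pow, hfv] at h6
  have h7 : F ^ 2 ≤ 1 + b ^ 2 := by nlinarith [sq_nonneg b]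
  nlinarith [pow_pos hb0 2, pow_pos hb0 4]

/-! ### The length measure on the unit circle -/

theorem plane_norm_sq (x : Plane) : ‖x‖ ^ 2 = x 0 ^ 2 + x 1 ^ 2 := by
  simp [EuclideanSpace.norm_sq_eq, Fin.sum_univ_two]

theorem mem_circle_iff {x : Plane} : x ∈ circle ↔ x 0 ^ 2 + x 1 ^ 2 = 1 := by
  rw [circle, mem_sphere_zero_iff_norm, ← plane_norm_sq,
    pow_eq_one_iff_of_nonneg (norm_nonneg x) two_ne_zero]

theorem measurableSet_circle : MeasurableSet circle := Metric.isClosed_sphere.measurableSet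

theorem ae_mem_circle : ∀ᵐ x ∂circleMeasure, x ∈ circle := ae_restrict_mem measurableSet_circle

/-- The circle is the Lipschitz image of a bounded interval. -/
instance isFiniteMeasure_circleMeasure : IsFiniteMeasure circleMeasure := by
  let γ : ℝ → Plane := fun θ => !₂[Real.cos θ, Real.sin θ]
  have hγ : LipschitzWith 2 γ := by
    refine LipschitzWith.of_dist_le_mul fun s t => ?_
    rw [dist_eq_norm, Real.dist_eq]
    refine abs_le_of_sq_le_sq' ?_ (by positivity) |>.2
    have h0 : (γ s - γ t) 0 = Real.cos s - Real.cos t := rfl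
    have h1 : (γ s - γ t) 1 = Real.sin s - Real.sin t := rfl
    have h2 := Real.abs_cos_sub_cos_le s t
    have h3 := Real.abs_sin_sub_sin_le s t
    rw [plane_norm_sq, h0, h1, ← sq_abs (Real.cos s - _), ← sq_abs (Real.sin s - _)]
    have h4 := pow_le_pow_left₀ (abs_nonneg _) h2 2
    have h5 := pow_le_pow_left₀ (abs_nonneg _) h3 2
    push_cast
    nlinarith [sq_nonneg |s - t|]
  have hsub : circle ⊆ γ '' Icc (-Real.pi) Real.pi := by
    intro x hx
    rw [mem_circle_iff] at hx
    have hz : ‖(⟨x 0, x 1⟩ : ℂ)‖ = 1 := by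
      rw [Complex.norm_def, Complex.normSq_apply, ← pow_two, ← pow_two, hx, Real.sqrt_one]
    have hz0 : (⟨x 0, x 1⟩ : ℂ) ≠ 0 := by
      rw [← norm_ne_zero_iff, hz]; exact one_ne_zero
    refine ⟨Complex.arg ⟨x 0, x 1⟩, ⟨(Complex.neg_pi_lt_arg _).le, Complex.arg_le_pi _⟩, ?_⟩
    ext i
    fin_cases i
    · change Real.cos _ = x 0
      rw [Complex.cos_arg hz0, hz, div_one]
    · change Real.sin _ = x 1
      rw [Complex.sin_arg, hz, div_one]
  refine ⟨?_⟩
  rw [circleMeasure, Measure.restrict_apply_univ]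
  calc Measure.hausdorffMeasure 1 circle
      ≤ Measure.hausdorffMeasure 1 (γ '' Icc (-Real.pi) Real.pi) := measure_mono hsub
    _ ≤ _ := hγ.lipschitzOnWith.hausdorffMeasure_image_le zero_le_one
    _ < ⊤ := by
      rw [hausdorffMeasure_real, Real.volume_Icc]
      exact ENNReal.mul_lt_top (by simp) ENNReal.ofReal_lt_top

/-- Arcs of the circle have positive length, since so do their projections. -/
theorem circleMeasure_arc_pos {κ : ℝ} (hκ : κ < 1) (hκ0 : 0 < κ) :
    0 < circleMeasure {x | κ < x 0} := by
  have hδ : 0 < √(1 - κ ^ 2) := Real.sqrt_pos.2 (by nlinarith)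
  have hlip : LipschitzWith 1 fun x : Plane => x 1 := by
    refine LipschitzWith.of_dist_le_mul fun x y => ?_
    rw [dist_eq_norm, dist_eq_norm, NNReal.coe_one, one_mul]
    exact PiLp.norm_apply_le (x - y) 1
  have hsub : Ioo 0 √(1 - κ ^ 2) ⊆ (fun x : Plane => x 1) '' ({x | κ < x 0} ∩ circle) := by
    intro y hy
    have h1 : y ^ 2 < 1 - κ ^ 2 := by
      rw [← Real.sq_sqrt (show 0 ≤ 1 - κ ^ 2 by nlinarith)]
      exact pow_lt_pow_left₀ hy.2 hy.1.le two_ne_zero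
    refine ⟨!₂[√(1 - y ^ 2), y], ⟨?_, ?_⟩, rfl⟩
    · change κ < √(1 - y ^ 2)
      exact Real.lt_sqrt_of_sq_lt (by linarith)
    · rw [mem_circle_iff]
      change √(1 - y ^ 2) ^ 2 + y ^ 2 = 1
      rw [Real.sq_sqrt (by nlinarith)]
      ring
  have hle := hlip.lipschitzOnWith.hausdorffMeasure_image_le
    (s := {x : Plane | κ < x 0} ∩ circle) zero_le_one
  rw [hausdorffMeasure_real] at hle
  have h2 := (measure_mono hsub).trans hle
  rw [Real.volume_Ioo, sub_zero, ENNReal.coe_one, ENNReal.one_rpow, one_mul] at h2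
  rw [circleMeasure, Measure.restrict_apply' measurableSet_circle]
  exact lt_of_lt_of_le (ENNReal.ofReal_pos.2 hδ) h2

/-! ### Calibrations of the relaxed functional -/

theorem IsNorm.recession_eq {f : Mat → ℝ} (hN : IsNorm f) : recession f = f :=
  recession_eq_self fun t ξ ht => by rw [hN.smul, abs_of_pos ht]

namespace BVFunction

/-- The absolutely continuous and singular parts of `|Dw|` add up to `|Dw|`. -/
theorem integral_add_integral_singular (w : BVFunction) {ψ : Plane → ℝ}
    (hψ : Integrable ψ w.variation) :
    (∫ x in disc, (w.variation.rnDeriv volume x).toReal * ψ x)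
      + ∫ x, ψ x ∂w.singularVariation = ∫ x, ψ x ∂w.variation := by
  have := w.finite
  set r := w.variation.rnDeriv volume with hr
  have hle : volume.withDensity r ≤ w.variation := Measure.withDensity_rnDeriv_le _ _
  have hdisc : (volume.withDensity r).restrict disc = volume.withDensity r := by
    refine Measure.restrict_eq_self_of_ae_mem ?_
    exact Measure.absolutelyContinuous_of_le hle w.concentrated
  have h1 : ∫ x, ψ x ∂(volume.withDensity r) = ∫ x in disc, (r x).toReal * ψ x := by
    rw [← hdisc, restrict_withDensity (show MeasurableSet disc from measurableSet_ball),
      integral_withDensity_eq_integral_toReal_smul (Measure.measurable_rnDeriv _ _)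
        (ae_restrict_of_ae (Measure.rnDeriv_lt_top _ _))]
    rfl
  rw [← h1, singularVariation, ← integral_add_measure (hψ.mono_measure hle)
    (hψ.mono_measure (Measure.singularPart_le _ _)), hr, Measure.rnDeriv_add_singularPart]

end BVFunction

theorem measurable_apply_polar {f : Mat → ℝ} (hf : Continuous f) (w : BVFunction) :
    Measurable fun x => f (w.polar x) :=
  hf.measurable.comp w.polar_measurable

theorem integrable_apply_polar {f : Mat → ℝ} (hf : Continuous f) {M : ℝ}
    (hM : ∀ ξ, |f ξ| ≤ M * ‖ξ‖) (w : BVFunction) :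
    Integrable (fun x => f (w.polar x)) w.variation := by
  have := w.finite
  refine Integrable.of_bound (measurable_apply_polar hf w).aestronglyMeasurable M ?_
  filter_upwards [w.polar_norm] with x hx
  simpa [hx] using hM (w.polar x)

/-- For a norm as integrand the functional is the integral over `|Dw|` plus the boundary term. -/
theorem relaxedFunctional_eq {f : Mat → ℝ} (hN : IsNorm f) (hf : Continuous f) {M : ℝ}
    (hM : ∀ ξ, |f ξ| ≤ M * ‖ξ‖) (u₀ : Plane → Plane) (w : BVFunction) (T : Plane → Plane) :
    relaxedFunctional f u₀ w T = (∫ x, f (w.polar x) ∂w.variation)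
      + ∫ x, f (tensor (u₀ x - T x) x) ∂circleMeasure := by
  rw [relaxedFunctional, hN.recession_eq,
    ← w.integral_add_integral_singular (integrable_apply_polar hf hM w)]
  simp only [BVFunction.acDensity, hN.smul, abs_of_nonneg ENNReal.toReal_nonneg]

/-- A bounded field `∑ᵢ gᵢ eᵢ ⊗ e₁` whose entries do not depend on `x₁` is divergence free. If its
dual norm is at most one, it bounds the relaxed functional from below by its flux against `u₀`. -/
theorem calibration_le {f : Mat → ℝ} (hN : IsNorm f) (hf : Continuous f) {M : ℝ}
    (hM : ∀ ξ, |f ξ| ≤ M * ‖ξ‖) {g : Fin 2 → Plane → ℝ} (hg : ∀ i, ContDiff ℝ ∞ (g i))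
    (hdiv : ∀ i x, partialDeriv 0 (g i) x = 0) (hg1 : ∀ i x, |g i x| ≤ 1)
    (hcal : ∀ x ξ, ∑ i, g i x * ξ (i, 0) ≤ f ξ) {u₀ : Plane → Plane} (hu₀ : ContDiff ℝ ∞ u₀)
    {w : BVFunction} {T : Plane → Plane} (hT : w.IsTrace T) :
    ∫ x, ∑ i, g i x * (u₀ x i * x 0) ∂circleMeasure ≤ relaxedFunctional f u₀ w T := by
  have hfin := w.finite
  rw [relaxedFunctional_eq hN hf hM]
  have hgm : ∀ i, Measurable (g i) := fun i => (hg i).continuous.measurable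
  have hpm : ∀ i, Measurable fun x => w.polar x (i, 0) := fun i => by
    have : Continuous fun ξ : Mat => ξ (i, 0) := by fun_prop
    exact this.measurable.comp w.polar_measurable
  -- the flux of the field through `Dw`
  have hint : ∀ i, Integrable (fun x => g i x * w.polar x (i, 0)) w.variation := fun i => by
    refine Integrable.of_bound ((hgm i).mul (hpm i)).aestronglyMeasurable 1 ?_
    filter_upwards [w.polar_norm] with x hx
    rw [norm_mul]
    have h1 := PiLp.norm_apply_le (w.polar x) (i, 0)
    rw [hx] at h1
    exact mul_le_one₀ (hg1 i x) (norm_nonneg _) h1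
  have hflux : ∀ i, ∫ x, g i x * w.polar x (i, 0) ∂w.variation
      = ∫ x, T x i * g i x * x 0 ∂circleMeasure := fun i => by
    have h1 := hT.gauss_green (g i) (hg i) i 0
    simp only [hdiv, mul_zero, integral_zero] at h1
    linarith
  have hinterior : ∑ i, ∫ x, T x i * g i x * x 0 ∂circleMeasure
      ≤ ∫ x, f (w.polar x) ∂w.variation := by
    simp only [← hflux]
    rw [← integral_finsetSum _ fun i _ => hint i]
    exact integral_mono (integrable_finsetSum _ fun i _ => hint i)
      (integrable_apply_polar hf hM w) fun x => hcal x _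
  -- the flux through the circle
  have hTi : ∀ i, Integrable (fun x => T x i) circleMeasure := fun i =>
    (EuclideanSpace.proj i : Plane →L[ℝ] ℝ).integrable_comp hT.integrable
  have hx0 : ∀ i, ∀ᵐ x ∂circleMeasure, ‖g i x * x 0‖ ≤ 1 := fun i => by
    filter_upwards [ae_mem_circle] with x hx
    rw [norm_mul]
    have h1 := PiLp.norm_apply_le x 0
    rw [mem_sphere_zero_iff_norm.1 hx] at h1
    exact mul_le_one₀ (hg1 i x) (norm_nonneg _) h1
  have hgx : ∀ i, Continuous fun x : Plane => g i x * x 0 := fun i =>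
    (hg i).continuous.mul (by fun_prop)
  have hTint : ∀ i, Integrable (fun x => T x i * g i x * x 0) circleMeasure := fun i => by
    refine ((hTi i).mul_bdd (hgx i).aestronglyMeasurable (hx0 i)).congr
      (Eventually.of_forall fun x => ?_)
    simp only [mul_assoc]
  have hu₀int : ∀ i, Integrable (fun x => g i x * (u₀ x i * x 0)) circleMeasure := fun i => by
    have hc : Continuous fun x : Plane => g i x * (u₀ x i * x 0) := by
      have h1 : Continuous fun x => u₀ x i :=
        (EuclideanSpace.proj i : Plane →L[ℝ] ℝ).continuous.comp hu₀.continuous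
      exact (hg i).continuous.mul (h1.mul (by fun_prop))
    obtain ⟨C, hC⟩ := ((isCompact_sphere (0 : Plane) 1).exists_bound_of_continuousOn hc.continuousOn)
    refine Integrable.of_bound hc.aestronglyMeasurable C ?_
    filter_upwards [ae_mem_circle] with x hx using hC x hx
  have hu₀c : Integrable u₀ circleMeasure := by
    obtain ⟨C, hC⟩ := ((isCompact_sphere (0 : Plane) 1).exists_bound_of_continuousOn
      hu₀.continuous.continuousOn)
    refine Integrable.of_bound hu₀.continuous.aestronglyMeasurable C ?_
    filter_upwards [ae_mem_circle] with x hx using hC x hx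
  have htens : Continuous fun p : Plane × Plane => tensor p.1 p.2 := by
    unfold tensor
    fun_prop
  have hbdint : Integrable (fun x => f (tensor (u₀ x - T x) x)) circleMeasure := by
    refine ((hu₀c.sub hT.integrable).norm.const_mul (2 * |M|)).mono' ?_ ?_
    · exact (hf.comp htens).comp_aestronglyMeasurable
        ((hu₀c.sub hT.integrable).aestronglyMeasurable.prodMk aestronglyMeasurable_id)
    · filter_upwards [ae_mem_circle] with x hx
      have h1 : ‖tensor (u₀ x - T x) x‖ ≤ 2 * ‖u₀ x - T x‖ := by
        refine abs_le_of_sq_le_sq' ?_ (by positivity) |>.2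
        rw [mem_circle_iff] at hx
        rw [norm_sq_eq_sum, mul_pow, plane_norm_sq]
        simp only [tensor_apply]
        nlinarith [sq_nonneg ((u₀ x - T x) 0), sq_nonneg ((u₀ x - T x) 1)]
      calc ‖f (tensor (u₀ x - T x) x)‖ ≤ M * ‖tensor (u₀ x - T x) x‖ := hM _
        _ ≤ |M| * (2 * ‖u₀ x - T x‖) :=
          mul_le_mul (le_abs_self M) h1 (norm_nonneg _) (abs_nonneg M)
        _ = 2 * |M| * ‖u₀ x - T x‖ := by ring
  have hboundary : ∫ x, (∑ i, g i x * (u₀ x i * x 0) - ∑ i, T x i * g i x * x 0) ∂circleMeasure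
      ≤ ∫ x, f (tensor (u₀ x - T x) x) ∂circleMeasure := by
    refine integral_mono ((integrable_finsetSum _ fun i _ => hu₀int i).sub
      (integrable_finsetSum _ fun i _ => hTint i)) hbdint fun x => ?_
    refine le_of_eq_of_le ?_ (hcal x _)
    rw [← Finset.sum_sub_distrib]
    refine Finset.sum_congr rfl fun i _ => ?_
    rw [tensor_apply, PiLp.sub_apply]
    ring
  rw [integral_sub (integrable_finsetSum _ fun i _ => hu₀int i)
    (integrable_finsetSum _ fun i _ => hTint i), integral_finsetSum _ fun i _ => hTint i]
    at hboundary
  linarith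

/-! ### The zero function -/

theorem isTrace_zero : (0 : BVFunction).IsTrace 0 where
  integrable := integrable_zero _ _ _
  gauss_green φ _ i j := by
    change ∫ x in disc, (0 : ℝ) * partialDeriv j φ x =
      -∫ x, φ x * (0 : ℝ) ∂(0 : Measure Plane) + ∫ x, (0 : ℝ) * φ x * x j ∂circleMeasure
    simp

theorem relaxedFunctional_zero {f : Mat → ℝ} (hN : IsNorm f) (hf : Continuous f) {M : ℝ}
    (hM : ∀ ξ, |f ξ| ≤ M * ‖ξ‖) (u₀ : Plane → Plane) :
    relaxedFunctional f u₀ 0 0 = ∫ x, f (tensor (u₀ x) x) ∂circleMeasure := by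
  rw [relaxedFunctional_eq hN hf hM]
  change (∫ x, f 0 ∂(0 : Measure Plane)) + ∫ x, f (tensor (u₀ x - 0) x) ∂circleMeasure = _
  simp

/-- A trace of the zero function has no flux through the circle. -/
theorem integral_trace_zero {T : Plane → Plane} (hT : (0 : BVFunction).IsTrace T) :
    ∫ x, T x 0 * x 0 ∂circleMeasure = 0 := by
  have h1 := hT.gauss_green (fun _ => 1) contDiff_const 0 0
  change ∫ x in disc, (0 : ℝ) * partialDeriv 0 (fun _ => 1) x =
    -∫ x, (1 : ℝ) * (0 : ℝ) ∂(0 : Measure Plane) + ∫ x, T x 0 * 1 * x 0 ∂circleMeasure at h1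
  simpa using h1.symm

/-! ### The calibration and the boundary datum -/

/-- A smooth cutoff on the line, equal to `1` for `s² ≤ 1 / 2` and to `0` for `s² ≥ 3 / 4`. -/
noncomputable def stripCutoff (s : ℝ) : ℝ := Real.smoothTransition (3 - 4 * s ^ 2)

/-- The coefficients of the calibration `(√(1 - x₂²) e₁ + x₂ e₂) ⊗ e₁`, cut off near `x₂ = ±1`,
where the square root is not smooth. On the right half of the circle and for `x₂² ≤ 1 / 2`, where
the cutoff is `1`, the calibration is `x ⊗ e₁`. -/
noncomputable def calibration (i : Fin 2) (x : Plane) : ℝ :=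
  stripCutoff (x 1) * ![√(1 - x 1 ^ 2), x 1] i

theorem contDiff_calibration_profile (i : Fin 2) :
    ContDiff ℝ ∞ fun s : ℝ => stripCutoff s * ![√(1 - s ^ 2), s] i := by
  have hc : ContDiff ℝ ∞ stripCutoff :=
    Real.smoothTransition.contDiff.comp
      (contDiff_const.sub (contDiff_const.mul (contDiff_id.pow 2)))
  fin_cases i
  · change ContDiff ℝ ∞ fun s : ℝ => stripCutoff s * √(1 - s ^ 2)
    refine contDiff_iff_contDiffAt.2 fun s => ?_
    rcases lt_or_ge (s ^ 2) 1 with hs | hs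
    · exact hc.contDiffAt.mul
        ((contDiffAt_const.sub (contDiffAt_id.pow 2)).sqrt (by simp only [id]; linarith))
    · refine (contDiffAt_const (c := (0 : ℝ))).congr_of_eventuallyEq ?_
      have ho : IsOpen {s : ℝ | 3 / 4 < s ^ 2} := isOpen_lt (by fun_prop) (by fun_prop)
      filter_upwards [ho.mem_nhds (show 3 / 4 < s ^ 2 by linarith)] with t ht
      have ht' : 3 / 4 < t ^ 2 := ht
      rw [stripCutoff, Real.smoothTransition.zero_of_nonpos (by linarith), zero_mul]
  · exact hc.mul contDiff_id

theorem hasFDerivAt_snd_coord (x : Plane) :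
    HasFDerivAt (fun x : Plane => x 1) (EuclideanSpace.proj 1 : Plane →L[ℝ] ℝ) x :=
  (EuclideanSpace.proj 1 : Plane →L[ℝ] ℝ).hasFDerivAt

theorem contDiff_calibration (i : Fin 2) : ContDiff ℝ ∞ (calibration i) :=
  (contDiff_calibration_profile i).comp (EuclideanSpace.proj 1 : Plane →L[ℝ] ℝ).contDiff

theorem partialDeriv_calibration (i : Fin 2) (x : Plane) :
    partialDeriv 0 (calibration i) x = 0 := by
  have h1 := ((contDiff_calibration_profile i).differentiable (by simp) (x 1)).hasFDerivAt.comp x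
    (hasFDerivAt_snd_coord x)
  have h2 : fderiv ℝ (calibration i) x = _ := h1.fderiv
  rw [partialDeriv, h2]
  simp [basisVec]

theorem calibration_sq_add_sq_le (x : Plane) : calibration 0 x ^ 2 + calibration 1 x ^ 2 ≤ 1 := by
  have h0 : calibration 0 x = stripCutoff (x 1) * √(1 - x 1 ^ 2) := rfl
  have h1 : calibration 1 x = stripCutoff (x 1) * x 1 := rfl
  rw [h0, h1, mul_pow, mul_pow]
  rcases le_or_gt (x 1 ^ 2) 1 with hs | hs
  · rw [Real.sq_sqrt (by linarith)]
    have h2 : stripCutoff (x 1) ^ 2 ≤ 1 :=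
      pow_le_one₀ (Real.smoothTransition.nonneg _) (Real.smoothTransition.le_one _)
    linarith
  · rw [stripCutoff, Real.smoothTransition.zero_of_nonpos (by linarith)]
    norm_num

theorem abs_calibration_le (i : Fin 2) (x : Plane) : |calibration i x| ≤ 1 := by
  rw [← sq_le_one_iff_abs_le_one]
  have := calibration_sq_add_sq_le x
  fin_cases i
  · change calibration 0 x ^ 2 ≤ 1
    nlinarith [sq_nonneg (calibration 1 x)]
  · change calibration 1 x ^ 2 ≤ 1
    nlinarith [sq_nonneg (calibration 0 x)]

theorem calibration_of_mem_circle {x : Plane} (hx : x ∈ circle) (h0 : 0 < x 0)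
    (h1 : x 1 ^ 2 ≤ 1 / 2) (i : Fin 2) : calibration i x = x i := by
  rw [mem_circle_iff] at hx
  have h2 : stripCutoff (x 1) = 1 := Real.smoothTransition.one_of_one_le (by linarith)
  have h3 : √(1 - x 1 ^ 2) = x 0 := by
    rw [← hx, add_sub_cancel_right, Real.sqrt_sq h0.le]
  rw [calibration, h2, h3, one_mul]
  fin_cases i <;> rfl

/-- The calibration has norm at most one, because `q` vanishes on matrices of the form `v ⊗ e₁`. -/
theorem sum_calibration_le {η : Mat → ℝ} {c : ℝ}
    (h : IsSmallPerturbation quadOperator (perturbation η) c) (x : Plane) (ξ : Mat) :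
    ∑ i, calibration i x * ξ (i, 0) ≤ dualNorm (perturbedQuadratic η) ξ := by
  have h1 := h.inner_le_dualNorm ξ (tensor (!₂[calibration 0 x, calibration 1 x]) (basisVec 0))
  rw [perturbedForm_of_apply_eq_zero _ (by simp [tensor_apply, basisVec]), inner_eq_sum] at h1
  simp only [tensor_apply, basisVec, PiLp.single_apply] at h1
  norm_num at h1
  have h2 : √(calibration 0 x ^ 2 + calibration 1 x ^ 2) ≤ 1 := by
    rw [Real.sqrt_le_one]
    exact calibration_sq_add_sq_le x
  rw [Fin.sum_univ_two]
  have h3 := mul_le_mul_of_nonneg_left h2 (h.dualNorm_nonneg ξ)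
  rw [mul_one] at h3
  rw [perturbedQuadratic_eq]
  linarith

/-- The boundary datum: the identity cut off to the arc `x₁ > κ` around `e₁`. -/
noncomputable def boundaryDatum (κ : ℝ) (x : Plane) : Plane :=
  Real.smoothTransition (x 0 - κ) • x

theorem contDiff_boundaryDatum (κ : ℝ) : ContDiff ℝ ∞ (boundaryDatum κ) :=
  (Real.smoothTransition.contDiff.comp
    ((EuclideanSpace.proj 0 : Plane →L[ℝ] ℝ).contDiff.sub contDiff_const)).smul contDiff_id

/-- On the circle, the calibration attains the norm of `u₀ ⊗ ν`. -/
theorem dualNorm_boundaryDatum {ε c κ : ℝ} (hε : 0 < ε) (hε1 : ε ≤ 1 / 100)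
    (h : IsSmallPerturbation quadOperator (perturbation (cutoff ε)) c)
    (hκ : 1 - ε ^ 2 / 4 ≤ κ) {x : Plane} (hx : x ∈ circle) :
    dualNorm (perturbedQuadratic (cutoff ε)) (tensor (boundaryDatum κ x) x)
      = ∑ i, calibration i x * (boundaryDatum κ x i * x 0) := by
  have ht : tensor (boundaryDatum κ x) x = Real.smoothTransition (x 0 - κ) • tensor x x := by
    ext p
    simp [tensor, boundaryDatum, mul_assoc]
  have hN : IsNorm (dualNorm (perturbedQuadratic (cutoff ε))) := h.isNorm_dualNorm
  have hb : ∀ i, boundaryDatum κ x i = Real.smoothTransition (x 0 - κ) * x i := fun i => rfl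
  rw [ht, hN.smul, abs_of_nonneg (Real.smoothTransition.nonneg _), Fin.sum_univ_two, hb, hb]
  rcases le_or_gt (x 0) κ with h0 | h0
  · rw [Real.smoothTransition.zero_of_nonpos (by linarith)]
    ring
  · have hc := mem_circle_iff.1 hx
    have hx0 : 1 - ε ^ 2 / 4 < x 0 := hκ.trans_lt h0
    have hx0' : 0 < x 0 := by nlinarith
    have hx0sq : (1 - ε ^ 2 / 4) ^ 2 ≤ x 0 ^ 2 := pow_le_pow_left₀ (by nlinarith) hx0.le 2
    -- `x₂² = 1 - x₁² < ε² / 2`, so `x` lies in the cone where the norm of `x ⊗ x` is known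
    have hε2 : 0 < ε ^ 2 := by positivity
    have hε2' : ε ^ 2 ≤ 1 / 100 := by nlinarith
    have hsq : x 1 ^ 2 < ε ^ 2 * x 0 ^ 2 := by nlinarith
    have hlt : |x 1| < ε * |x 0| := by
      refine lt_of_pow_lt_pow_left₀ 2 (by positivity) ?_
      rw [mul_pow, sq_abs, sq_abs]
      exact hsq
    have hx' : x = x 0 • basisVec 0 + x 1 • basisVec 1 := by
      ext i
      fin_cases i <;> simp [basisVec]
    have h1 := dualNorm_tensor_sq hε h hlt hx'
    rw [hc, mul_one] at h1
    have h2 : dualNorm (perturbedQuadratic (cutoff ε)) (tensor x x) = x 0 :=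
      (sq_eq_sq₀ (h.dualNorm_nonneg _) hx0'.le).1 h1
    have h3 : x 1 ^ 2 ≤ 1 / 2 := by nlinarith
    rw [h2, calibration_of_mem_circle hx hx0' h3, calibration_of_mem_circle hx hx0' h3]
    linear_combination (-(Real.smoothTransition (x 0 - κ) * x 0)) * hc

/-- Traces of the zero function have no flux through the circle, but the datum has. -/
theorem circleMeasure_trace_ne_pos {κ : ℝ} (hκ0 : 0 < κ) (hκ : κ < 1) {T : Plane → Plane}
    (hT : (0 : BVFunction).IsTrace T) : 0 < circleMeasure {x | T x ≠ boundaryDatum κ x} := by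
  refine pos_iff_ne_zero.2 fun h0 => ?_
  have hae : ∀ᵐ x ∂circleMeasure, T x = boundaryDatum κ x := h0
  have h1 : ∫ x, Real.smoothTransition (x 0 - κ) * x 0 ^ 2 ∂circleMeasure = 0 := by
    rw [← integral_trace_zero hT]
    refine integral_congr_ae ?_
    filter_upwards [hae] with x hx
    rw [hx]
    simp only [boundaryDatum, PiLp.smul_apply, smul_eq_mul]
    ring
  have hc : Continuous fun x : Plane => Real.smoothTransition (x 0 - κ) * x 0 ^ 2 :=
    (Real.smoothTransition.continuous.comp (by fun_prop)).mul (by fun_prop)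
  have hint : Integrable (fun x : Plane => Real.smoothTransition (x 0 - κ) * x 0 ^ 2)
      circleMeasure := by
    refine Integrable.of_bound hc.aestronglyMeasurable 1 ?_
    filter_upwards [ae_mem_circle] with x hx
    rw [mem_circle_iff] at hx
    rw [norm_mul, Real.norm_of_nonneg (Real.smoothTransition.nonneg _),
      Real.norm_of_nonneg (sq_nonneg _)]
    exact mul_le_one₀ (Real.smoothTransition.le_one _) (sq_nonneg _)
      (by nlinarith [sq_nonneg (x 1)])
  rw [integral_eq_zero_iff_of_nonneg (fun x => mul_nonneg (Real.smoothTransition.nonneg _)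
    (sq_nonneg _)) hint] at h1
  refine (circleMeasure_arc_pos hκ hκ0).ne' (measure_mono_null (fun x hx => ?_) h1)
  have hx' : κ < x 0 := hx
  exact (mul_pos (Real.smoothTransition.pos_of_pos (sub_pos.2 hx'))
    (pow_pos (hκ0.trans hx') 2)).ne'

namespace IsSmallPerturbation

theorem continuous_dualNorm {A : Mat →L[ℝ] Mat} {q : Mat → ℝ} {c : ℝ}
    (h : IsSmallPerturbation A q c) : Continuous (dualNorm fun y => √(perturbedForm A q y)) := by
  have h1 : Continuous (perturbedForm A q) :=
    continuous_iff_continuousAt.2 fun x => (h.hasFDerivAt_perturbedForm x).continuousAt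
  have h2 : (dualNorm fun y => √(perturbedForm A q y))
      = fun x => √(perturbedForm A q (h.gradientInverse x)) := by
    ext x
    exact h.dualNorm_eq x
  rw [h2]
  exact Real.continuous_sqrt.comp (h1.comp h.continuous_gradientInverse)

end IsSmallPerturbation

theorem isRelaxedMinimizer_zero {ε c κ : ℝ} (hε : 0 < ε) (hε1 : ε ≤ 1 / 100)
    (h : IsSmallPerturbation quadOperator (perturbation (cutoff ε)) c)
    (hκ : 1 - ε ^ 2 / 4 ≤ κ) :
    IsRelaxedMinimizer (dualNorm (perturbedQuadratic (cutoff ε))) (boundaryDatum κ) 0 := by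
  have hN : IsNorm (dualNorm (perturbedQuadratic (cutoff ε))) := h.isNorm_dualNorm
  have hf : Continuous (dualNorm (perturbedQuadratic (cutoff ε))) := h.continuous_dualNorm
  have hM : ∀ ξ, |dualNorm (perturbedQuadratic (cutoff ε)) ξ| ≤ √(2 / c) * ‖ξ‖ := fun ξ => by
    have h0 : 0 ≤ dualNorm (perturbedQuadratic (cutoff ε)) ξ := h.dualNorm_nonneg ξ
    rw [abs_of_nonneg h0]
    exact h.dualNorm_le_norm ξ
  refine ⟨0, isTrace_zero, fun w T hT => ?_⟩
  refine le_of_eq_of_le ?_ (calibration_le hN hf hM contDiff_calibration partialDeriv_calibration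
    abs_calibration_le (sum_calibration_le h) (contDiff_boundaryDatum κ) hT)
  rw [relaxedFunctional_zero hN hf hM]
  refine integral_congr_ae ?_
  filter_upwards [ae_mem_circle] with x hx
  exact dualNorm_boundaryDatum hε hε1 h hκ hx

end BoundaryExample

open BoundaryExample in
theorem theorem1p5 :
    ∃ f : Mat → ℝ,
      -- `f` is an even, positively `1`-homogeneous norm, smooth away from the origin
      IsNorm f ∧
      (∀ ξ, f (-ξ) = f ξ) ∧
      (∀ (t : ℝ) (ξ : Mat), 0 < t → f (t • ξ) = t * f ξ) ∧
      ContDiffOn ℝ ∞ f {0}ᶜ ∧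
      -- it satisfies every structural assumption except the quasi-isotropy
      AdmissibleIntegrand f ∧
      ¬ QuasiIsotropic f ∧
      -- it is the dual of an explicit perturbed quadratic norm, and its gradient is explicit
      -- at `v ⊗ v` for `v = a e₁ + b e₂` close to the first axis
      (∃ ε : ℝ, 0 < ε ∧
        (∃ η : Mat → ℝ, IsCutoff ε η ∧ IsNorm (perturbedQuadratic η) ∧
          f = dualNorm (perturbedQuadratic η)) ∧
        ∀ (a b : ℝ) (v : Plane), |b| < ε * |a| → v = a • basisVec 0 + b • basisVec 1 →
          HasGradientAt f ((a / f (tensor v v)) • tensor v (basisVec 0)) (tensor v v)) ∧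
      -- for some smooth nonzero datum on the circle, the zero function is a minimiser of the
      -- relaxed problem, and its trace differs from the datum on a set of positive length
      ∃ u₀ : Plane → Plane, ContDiff ℝ ∞ u₀ ∧ (∃ x ∈ circle, u₀ x ≠ 0) ∧
        IsRelaxedMinimizer f u₀ 0 ∧
        ∀ T : Plane → Plane, (0 : BVFunction).IsTrace T →
          0 < circleMeasure {x | T x ≠ u₀ x} := by
  obtain ⟨ε, hε, hε1, h⟩ := exists_isSmallPerturbation
  have hN : IsNorm (dualNorm (perturbedQuadratic (cutoff ε))) := h.isNorm_dualNorm
  have hκ : 1 - ε ^ 2 / 4 < 1 := by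
    have : 0 < ε ^ 2 := by positivity
    linarith
  have hκ0 : 0 < 1 - ε ^ 2 / 4 := by nlinarith
  refine ⟨dualNorm (perturbedQuadratic (cutoff ε)), hN, fun ξ => ?_, fun t ξ ht => ?_,
    fun x hx => (h.contDiffAt_dualNorm hx).contDiffWithinAt, h.admissibleIntegrand,
    not_quasiIsotropic hε h,
    ⟨ε, hε, ⟨cutoff ε, isCutoff_cutoff hε, h.isNorm_sqrt, rfl⟩,
      fun a b v hab hv => hasGradientAt_dualNorm_tensor hε h hab hv⟩,
    boundaryDatum (1 - ε ^ 2 / 4), contDiff_boundaryDatum _, ⟨basisVec 0, ?_, ?_⟩,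
    isRelaxedMinimizer_zero hε hε1 h le_rfl, fun T hT => circleMeasure_trace_ne_pos hκ0 hκ hT⟩
  · simpa using hN.smul (-1) ξ
  · rw [hN.smul, abs_of_pos ht]
  · rw [mem_circle_iff]
    simp [basisVec]
  · intro h0
    have h1 := congrArg (fun x : Plane => x 0) h0
    have h2 : 0 < (1 : ℝ) - (1 - ε ^ 2 / 4) := by linarith
    have h3 := Real.smoothTransition.pos_of_pos h2
    simp only [boundaryDatum, basisVec, PiLp.smul_apply, PiLp.single_apply, if_true, smul_eq_mul,
      mul_one, PiLp.zero_apply] at h1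
    exact h3.ne' h1
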